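/- Let $A\in\mathbb R^{n\times n}$, $C\in\mathbb R^{m\times n}$, $Q\ge 0$, $R>0$, $\Sigma_0\ge 0$ with spectral radius $\rho(A)<1$. Consider $$x(t+1)=Ax(t)+w(t),\qquad y(t)=Cx(t)+v(t),\qquad t\ge 0,$$ where $x(0)\sim\mathcal N(0,\Sigma_0)$, $w(t)\sim\mathcal N(0,Q)$, $v(t)\sim\mathcal N(0,R)$, $t\ge0$, are all independent, and the linear filter with constant gain $K\in\mathbb R^{n\times m}$, $$\hat x(t+1)=A\hat x(t)+K\,[\,y(t+1)-CA\hat x(t)\,],$$ with an arbitrary deterministic initial value $\hat x(0)$. Call $K$ admissible if $\rho(A-KCA)<1$. With $e(t)=x(t)-\hat x(t)$ put $$P(K)=\lim_{t\to\infty}\mathbb E[e(t)e(t)^{\mathsf T}],\qquad \mathcal P(K)=\operatorname{tr}P(K),\qquad \mathcal S(K)=\operatorname{tr}\Big[\frac{d}{dR}\mathcal P(K)\Big],$$ where $\frac{d}{dR}$ is the gradient with respect to the symmetric matrix $R$ for the inner product $\langle G,D\rangle=\operatorname{tr}(G^{\mathsf T}D)$. For $V\ge0$ and $W>0$ consider the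 Riccati equation $$X=AXA^{\mathsf T}-AXC^{\mathsf T}(CXC^{\mathsf T}+W)^{-1}CXA^{\mathsf T}+V. \qquad (\ast)$$ Let $K_{\rm kf}=XC^{\mathsf T}(CXC^{\mathsf T}+R)^{-1}$, where $X\ge 0$ solves $(\ast)$ with $V=Q$, $W=R$ (the steady-state Kalman gain), and for $\lambda\ge0$ let $$K^*(\lambda)=XC^{\mathsf T}(CXC^{\mathsf T}+I_m+\lambda R)^{-1},$$ where $X\ge0$ solves $(\ast)$ with $V=\lambda Q$, $W=I_m+\lambda R$. **Theorem.** 1. For every admissible $K$ the limit $P(K)$ and the derivative $\frac{d}{dR}\mathcal P(K)$ exist. 2. Equation $(\ast)$ with $V=Q$, $W=R$ has a unique solution $X\ge0$, and $K_{\rm kf}$ is the unique minimizer of $\mathcal P$ over admissible gains. 3. For every $\lambda\ge0$, equation $(\ast)$ with $V=\lambda Q$, $W=I_m+\lambda R$ has a unique solution $X\ge0$, and $K^*(\lambda)$ is the unique minimizer of $\mathcal S+\lambda\mathcal P$ over admissible gains. 4. Let $\delta\in[\mathcal P(K_{\rm kf}),\mathcal P(0)]$ and let $\lambda\ge0$ satisfy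 $\mathcal P(K^*(\lambda))=\delta$. Then $K^*(\lambda)$ is the unique global minimizer of the problem $$\min_{K\ \text{admissible}}\ \mathcal S(K)\quad\text{subject to}\quad \mathcal P(K)\le\delta .$$ 5. For every $\delta$ with $\mathcal P(K_{\rm kf})<\delta\le\mathcal P(0)$ there is exactly one $\lambda\ge0$ with $\mathcal P(K^*(\lambda))=\delta$. Moreover $K^*(0)=0$. 6. For $\delta=\mathcal P(K_{\rm kf})$ (the limiting case $\lambda=\infty$) the unique global minimizer of this problem is $K_{\rm kf}$, and $K_{\rm kf}=\lim_{\lambda\to\infty}K^*(\lambda)$. -/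

import Mathlib

open MeasureTheory ProbabilityTheory Filter Topology

noncomputable section

/-- A real square matrix is (Schur) stable if its spectral radius, computed over `ℂ`, is less
than one. -/
def SchurStable {n : ℕ} (M : Matrix (Fin n) (Fin n) ℝ) : Prop :=
  spectralRadius ℂ (M.map (algebraMap ℝ ℂ)) < 1

/-- The data of the system `x(t+1) = A x(t) + w(t)`, `y(t) = C x(t) + v(t)`: the matrices `A`, `C`,
the covariances `Q`, `R`, `Sigma0` of `w(t)`, `v(t)`, `x(0)`, and the (deterministic) initial
value `xhat0` of the filter. -/
structure LinearGaussianSystem (n m : ℕ) where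
  A : Matrix (Fin n) (Fin n) ℝ
  C : Matrix (Fin m) (Fin n) ℝ
  Q : Matrix (Fin n) (Fin n) ℝ
  R : Matrix (Fin m) (Fin m) ℝ
  Sigma0 : Matrix (Fin n) (Fin n) ℝ
  xhat0 : Fin n → ℝ

/-- Right-hand side of the discrete Riccati equation with noise weights `V` and `W`. -/
def riccatiMap {n m : ℕ} (A : Matrix (Fin n) (Fin n) ℝ) (C : Matrix (Fin m) (Fin n) ℝ)
    (V : Matrix (Fin n) (Fin n) ℝ) (W : Matrix (Fin m) (Fin m) ℝ)
    (X : Matrix (Fin n) (Fin n) ℝ) : Matrix (Fin n) (Fin n) ℝ :=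
  A * X * A.transpose
    - A * X * C.transpose * (C * X * C.transpose + W)⁻¹ * C * X * A.transpose + V

/-- `X` is a positive semidefinite solution of the Riccati equation. -/
def IsRiccatiSolution {n m : ℕ} (A : Matrix (Fin n) (Fin n) ℝ) (C : Matrix (Fin m) (Fin n) ℝ)
    (V : Matrix (Fin n) (Fin n) ℝ) (W : Matrix (Fin m) (Fin m) ℝ)
    (X : Matrix (Fin n) (Fin n) ℝ) : Prop :=
  X.PosSemidef ∧ X = riccatiMap A C V W X

/-- The positive semidefinite solution of the Riccati equation (meaningful when there is exactly
one). -/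
def riccatiSolution {n m : ℕ} (A : Matrix (Fin n) (Fin n) ℝ) (C : Matrix (Fin m) (Fin n) ℝ)
    (V : Matrix (Fin n) (Fin n) ℝ) (W : Matrix (Fin m) (Fin m) ℝ) : Matrix (Fin n) (Fin n) ℝ :=
  Classical.epsilon fun X => IsRiccatiSolution A C V W X

/-- The gain `X Cᵀ (C X Cᵀ + W)⁻¹`. -/
def gainOf {n m : ℕ} (C : Matrix (Fin m) (Fin n) ℝ) (W : Matrix (Fin m) (Fin m) ℝ)
    (X : Matrix (Fin n) (Fin n) ℝ) : Matrix (Fin n) (Fin m) ℝ :=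
  X * C.transpose * (C * X * C.transpose + W)⁻¹

namespace LinearGaussianSystem

variable {n m : ℕ} (s : LinearGaussianSystem n m)

/-- Sample space of the noises: `ω = (x(0), w, v)`. -/
abbrev Sample (n m : ℕ) : Type :=
  EuclideanSpace ℝ (Fin n) × (ℕ → EuclideanSpace ℝ (Fin n)) × (ℕ → EuclideanSpace ℝ (Fin m))

/-- The joint law of `(x(0), w, v)`: all of `x(0)`, `w(0), w(1), …`, `v(0), v(1), …` are
independent, with `x(0) ∼ N(0, Sigma0)`, `w(t) ∼ N(0, Q)` and `v(t) ∼ N(0, R)`. -/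
def noiseLaw : Measure (Sample n m) :=
  (multivariateGaussian 0 s.Sigma0).prod
    ((Measure.infinitePi fun _ : ℕ => multivariateGaussian 0 s.Q).prod
      (Measure.infinitePi fun _ : ℕ => multivariateGaussian 0 s.R))

/-- The state `x(t)`. -/
def state (ω : Sample n m) : ℕ → Fin n → ℝ
  | 0 => WithLp.ofLp ω.1
  | t + 1 => s.A.mulVec (state ω t) + WithLp.ofLp (ω.2.1 t)

/-- The measured output `y(t)`. -/
def output (ω : Sample n m) (t : ℕ) : Fin m → ℝ :=
  s.C.mulVec (s.state ω t) + WithLp.ofLp (ω.2.2 t)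

/-- The estimate `x̂(t)` of the linear filter with constant gain `K`. -/
def estimate (K : Matrix (Fin n) (Fin m) ℝ) (ω : Sample n m) : ℕ → Fin n → ℝ
  | 0 => s.xhat0
  | t + 1 => s.A.mulVec (estimate K ω t)
      + K.mulVec (s.output ω (t + 1) - (s.C * s.A).mulVec (estimate K ω t))

/-- The estimation error `e(t) = x(t) - x̂(t)`. -/
def error (K : Matrix (Fin n) (Fin m) ℝ) (ω : Sample n m) (t : ℕ) : Fin n → ℝ :=
  s.state ω t - s.estimate K ω t

/-- The error covariance `P(t) = 𝔼[e(t) e(t)ᵀ]`. -/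
def errorCov (K : Matrix (Fin n) (Fin m) ℝ) (t : ℕ) : Matrix (Fin n) (Fin n) ℝ :=
  Matrix.of fun i j => ∫ ω, s.error K ω t i * s.error K ω t j ∂s.noiseLaw

/-- The gain `K` is admissible if `A_K = A - K C A` is stable. -/
def Admissible (K : Matrix (Fin n) (Fin m) ℝ) : Prop :=
  SchurStable (s.A - K * s.C * s.A)

/-- The steady-state error covariance `P(K) = lim P(t)`. -/
def steadyCov (K : Matrix (Fin n) (Fin m) ℝ) : Matrix (Fin n) (Fin n) ℝ :=
  limUnder atTop (s.errorCov K)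

/-- The steady-state error `𝒫(K) = tr P(K)`. -/
def perf (K : Matrix (Fin n) (Fin m) ℝ) : ℝ :=
  (s.steadyCov K).trace

/-- The same system with measurement-noise covariance `R'`. -/
def withR (R' : Matrix (Fin m) (Fin m) ℝ) : LinearGaussianSystem n m :=
  { s with R := R' }

/-- The derivative `d𝒫(K)/dR`, for `𝒫(K)` as a function of the symmetric matrix `R`: the `(i, j)`
entry is the derivative in the direction `(E_ij + E_ji) / 2`. This is the gradient for the
inner product `⟨G, D⟩ = tr (Gᵀ D)` on symmetric matrices. -/
def perfGradR (K : Matrix (Fin n) (Fin m) ℝ) : Matrix (Fin m) (Fin m) ℝ :=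
  Matrix.of fun i j => deriv (fun ε : ℝ =>
    (s.withR (s.R + ε • ((1 / 2 : ℝ) • (Matrix.single i j (1 : ℝ) + Matrix.single j i (1 : ℝ))))).perf
      K) 0

/-- The sensitivity `𝒮(K) = tr (d𝒫(K)/dR)`. -/
def sens (K : Matrix (Fin n) (Fin m) ℝ) : ℝ :=
  (s.perfGradR K).trace

/-- The steady-state Kalman gain. -/
def kalmanGain : Matrix (Fin n) (Fin m) ℝ :=
  gainOf s.C s.R (riccatiSolution s.A s.C s.Q s.R)

/-- The gain `K*(lam)`. -/
def optGain (lam : ℝ) : Matrix (Fin n) (Fin m) ℝ :=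
  gainOf s.C (1 + lam • s.R) (riccatiSolution s.A s.C (lam • s.Q) (1 + lam • s.R))

/-- The feasible gains of the problem `min 𝒮(K)` subject to `𝒫(K) ≤ δ`. -/
def feasible (δ : ℝ) : Set (Matrix (Fin n) (Fin m) ℝ) :=
  {K | s.Admissible K ∧ s.perf K ≤ δ}

end LinearGaussianSystem

/-- `a` is the unique global minimizer of `f` on `S`. -/
def IsUniqueMinimizer {α : Type*} (f : α → ℝ) (S : Set α) (a : α) : Prop :=
  a ∈ S ∧ ∀ b ∈ S, b ≠ a → f a < f b

end

/-! Write `A_K = A - KCA`. The error obeys `e(t+1) = A_K e(t) + (1 - KC) w(t) - K v(t+1)` with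
uncorrelated terms, so its covariance satisfies `P(t+1) = A_K P(t) A_Kᵀ + N(K)`, where `N(K)` is
`filterNoise`. For stable `A_K` the limit is `L_K(N(K))`, with `L_K` the linear solution operator of
the Lyapunov equation (`SchurStable.lyapunov`).

Since `N(K)` is affine in `R`, the derivative of `𝒫` in direction `D` is `tr L_K(K D Kᵀ)`, hence
`𝒮(K) = tr L_K(K Kᵀ)`. Therefore `𝒮 + λ𝒫` is itself a steady-state error, for the noise covariances
`λQ` and `I + λR`, and its minimizer is a Kalman gain for these weights
(`Admissible.sens_add_smul_perf`).

Optimality of a Riccati gain `G` comes from completing the square: `L_K(N(K)) = P* + L_K((K -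
G)(CXCᵀ + W)(K - G)ᵀ)` (`IsRiccatiSolution.lyapunov_sub`), and the last term has positive trace
unless `K = G`. Stability of `A` makes `G` admissible.

The constrained problem is then a Lagrange multiplier argument. Existence of the multiplier is the
intermediate value theorem between `K*(0) = 0` and `K*(λ) → K_kf`. For uniqueness, two multipliers
with the same `δ` share their gain; the gain equation is affine in `λ`, so this gain is `K_kf`
(`optGain_eq_kalmanGain`). All continuity statements rest on compactness: a bounded family of
positive semidefinite solutions converges once each limit point solves an equation with a unique
solution. -/

open scoped Matrix

/-! ### Powers and left eigenvectors of stable matrices. -/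

section Stability

variable {n : ℕ} {M : Matrix (Fin n) (Fin n) ℝ}

/-- By Gelfand's formula `‖Z ^ k‖ ≤ r ^ k` eventually, for some `r < 1`, where `Z` is the
complexification of `M`; taking real parts returns to `M`. -/
theorem SchurStable.tendsto_pow (hM : SchurStable M) :
    Tendsto (fun k : ℕ => M ^ k) atTop (𝓝 0) := by
  let _ : NormedRing (Matrix (Fin n) (Fin n) ℂ) := Matrix.linftyOpNormedRing
  let _ : NormedAlgebra ℂ (Matrix (Fin n) (Fin n) ℂ) := Matrix.linftyOpNormedAlgebra
  set Z := M.map (algebraMap ℝ ℂ) with hZ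
  have hρ : spectralRadius ℂ Z < 1 := hM
  obtain ⟨r, hr, hr1⟩ := ENNReal.lt_iff_exists_nnreal_btwn.1 hρ
  have hr1 : r < 1 := by exact_mod_cast hr1
  have h1 := (spectrum.pow_nnnorm_pow_one_div_tendsto_nhds_spectralRadius Z).eventually
    (eventually_lt_nhds hr)
  have h2 : ∀ᶠ k : ℕ in atTop, ‖Z ^ k‖ ≤ (r : ℝ) ^ k := by
    filter_upwards [h1, eventually_gt_atTop 0] with k hk hk0
    have hk' : (‖Z ^ k‖₊ : ENNReal) ≤ (r : ENNReal) ^ (k : ℝ) := by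
      have := ENNReal.rpow_le_rpow hk.le (Nat.cast_nonneg k : (0 : ℝ) ≤ k)
      rwa [← ENNReal.rpow_mul, one_div, inv_mul_cancel₀ (by positivity), ENNReal.rpow_one] at this
    rw [ENNReal.rpow_natCast] at hk'
    exact_mod_cast hk'
  have h3 : Tendsto (fun k : ℕ => Z ^ k) atTop (𝓝 0) :=
    squeeze_zero_norm' h2 (tendsto_pow_atTop_nhds_zero_of_lt_one r.2 (by exact_mod_cast hr1))
  have h4 : Tendsto (fun k : ℕ => (Z ^ k).map Complex.re) atTop
      (𝓝 ((0 : Matrix (Fin n) (Fin n) ℂ).map Complex.re)) :=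
    ((continuous_id.matrix_map Complex.continuous_re).tendsto 0).comp h3
  have h5 : ∀ k : ℕ, (Z ^ k).map Complex.re = M ^ k := by
    intro k
    have : Z ^ k = (M ^ k).map (algebraMap ℝ ℂ) := by
      rw [hZ]
      exact ((algebraMap ℝ ℂ).mapMatrix.map_pow M k).symm
    rw [this]
    ext i j
    simp
  simpa [h5] using h4

/-- A matrix is stable if no complex number outside the open unit disc is a left eigenvalue. -/
theorem schurStable_of_forall_vecMul
    (h : ∀ (μ : ℂ) (z : Fin n → ℂ), z ᵥ* M.map (algebraMap ℝ ℂ) = μ • z → 1 ≤ ‖μ‖ → z = 0) :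
    SchurStable M := by
  let _ : NormedRing (Matrix (Fin n) (Fin n) ℂ) := Matrix.linftyOpNormedRing
  let _ : NormedAlgebra ℂ (Matrix (Fin n) (Fin n) ℂ) := Matrix.linftyOpNormedAlgebra
  unfold SchurStable
  set Z := M.map (algebraMap ℝ ℂ) with hZ
  -- For `n = 0` the spectrum is empty, while the pointwise criterion for the spectral radius needs
  -- a nonempty one.
  rcases subsingleton_or_nontrivial (Matrix (Fin n) (Fin n) ℂ) with hs | hs
  · rw [spectrum.SpectralRadius.of_subsingleton]
    exact zero_lt_one
  have key : spectralRadius ℂ Z < ((1 : NNReal) : ENNReal) := by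
    refine spectrum.spectralRadius_lt_of_forall_lt Z fun μ hμ => ?_
    by_contra hlt
    have h1 : 1 ≤ ‖μ‖ := by
      have := not_lt.1 hlt
      exact_mod_cast this
    have hdet : (algebraMap ℂ (Matrix (Fin n) (Fin n) ℂ) μ - Z).det = 0 := by
      have := spectrum.mem_iff.1 hμ
      rw [Matrix.isUnit_iff_isUnit_det, isUnit_iff_ne_zero, not_not] at this
      exact this
    obtain ⟨z, hz, hz0⟩ := Matrix.exists_vecMul_eq_zero_iff.2 hdet
    refine hz (h μ z ?_ h1)
    rw [Matrix.vecMul_sub, sub_eq_zero] at hz0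
    rw [← hz0, Algebra.algebraMap_eq_smul_one, Matrix.vecMul_smul, Matrix.vecMul_one]
  simpa using key

theorem SchurStable.eq_zero_of_vecMul (hM : SchurStable M) {μ : ℂ} {z : Fin n → ℂ}
    (hz : z ᵥ* M.map (algebraMap ℝ ℂ) = μ • z) (hμ : 1 ≤ ‖μ‖) : z = 0 := by
  by_contra hz0
  have hmem : μ ∈ spectrum ℂ (M.map (algebraMap ℝ ℂ)) := by
    rw [spectrum.mem_iff, Matrix.isUnit_iff_isUnit_det, isUnit_iff_ne_zero, not_not,
      ← Matrix.exists_vecMul_eq_zero_iff]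
    refine ⟨z, hz0, ?_⟩
    rw [Matrix.vecMul_sub, hz, Algebra.algebraMap_eq_smul_one, Matrix.vecMul_smul,
      Matrix.vecMul_one, sub_self]
  have h1 : (‖μ‖₊ : ENNReal) ≤ spectralRadius ℂ (M.map (algebraMap ℝ ℂ)) :=
    le_iSup₂ (f := fun (k : ℂ) (_ : k ∈ spectrum ℂ (M.map (algebraMap ℝ ℂ))) =>
      (‖k‖₊ : ENNReal)) μ hmem
  have h2 : (‖μ‖₊ : ENNReal) < 1 := lt_of_le_of_lt h1 hM
  have h3 : ‖μ‖₊ < 1 := by exact_mod_cast h2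
  have h4 : ‖μ‖ < 1 := by exact_mod_cast h3
  linarith

end Stability

/-! ### The Lyapunov equation, and compactness in the positive semidefinite cone. -/

section Lyapunov

variable {n : ℕ} {M N X : Matrix (Fin n) (Fin n) ℝ}

/-- The difference `P t - X` is conjugated by `M` at every step, so it equals `M ^ t * (P 0 - X) *
(M ^ t)ᵀ`. -/
theorem SchurStable.tendsto_of_recursion (hM : SchurStable M)
    {P : ℕ → Matrix (Fin n) (Fin n) ℝ} (hP : ∀ t, P (t + 1) = M * P t * Mᵀ + N)
    (hX : X = M * X * Mᵀ + N) : Tendsto P atTop (𝓝 X) := by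
  have h1 : ∀ t, P t = X + M ^ t * (P 0 - X) * (M ^ t)ᵀ := by
    intro t
    induction t with
    | zero => simp
    | succ t ih =>
      calc P (t + 1) = (M * X * Mᵀ + N) + M ^ (t + 1) * (P 0 - X) * (M ^ (t + 1))ᵀ := by
            rw [hP, ih, pow_succ', Matrix.transpose_mul]
            noncomm_ring
        _ = _ := by rw [← hX]
  have h2 : Tendsto (fun t : ℕ => X + M ^ t * (P 0 - X) * (M ^ t)ᵀ) atTop
      (𝓝 (X + 0 * (P 0 - X) * (0 : Matrix (Fin n) (Fin n) ℝ)ᵀ)) := by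
    have hc : Continuous fun Y : Matrix (Fin n) (Fin n) ℝ => X + Y * (P 0 - X) * Yᵀ := by
      fun_prop
    exact (hc.tendsto 0).comp hM.tendsto_pow
  have h3 : P = fun t => X + M ^ t * (P 0 - X) * (M ^ t)ᵀ := funext h1
  rw [h3]
  simpa using h2

theorem SchurStable.lyapunov_unique (hM : SchurStable M) {Y : Matrix (Fin n) (Fin n) ℝ}
    (hX : X = M * X * Mᵀ + N) (hY : Y = M * Y * Mᵀ + N) : X = Y :=
  tendsto_nhds_unique tendsto_const_nhds
    (hM.tendsto_of_recursion (P := fun _ => X) (fun _ => hX) hY)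

/-- The linear map `X ↦ X - M X Mᵀ`. -/
def lyapunovMap (M : Matrix (Fin n) (Fin n) ℝ) :
    Matrix (Fin n) (Fin n) ℝ →ₗ[ℝ] Matrix (Fin n) (Fin n) ℝ where
  toFun X := X - M * X * Mᵀ
  map_add' X Y := by noncomm_ring
  map_smul' c X := by simp [smul_sub]

theorem SchurStable.lyapunovMap_injective (hM : SchurStable M) :
    Function.Injective (lyapunovMap M) := by
  rw [injective_iff_map_eq_zero]
  intro X hX
  have h : X - M * X * Mᵀ = 0 := hX
  refine hM.lyapunov_unique (N := 0) (by rw [add_zero]; exact sub_eq_zero.1 h) (by simp)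

/-- The solution of `X = M X Mᵀ + N`, as a linear function of `N`. -/
noncomputable def SchurStable.lyapunov (hM : SchurStable M) :
    Matrix (Fin n) (Fin n) ℝ →ₗ[ℝ] Matrix (Fin n) (Fin n) ℝ :=
  (LinearEquiv.ofInjectiveEndo (lyapunovMap M) hM.lyapunovMap_injective).symm.toLinearMap

theorem SchurStable.lyapunov_eq (hM : SchurStable M) (N : Matrix (Fin n) (Fin n) ℝ) :
    hM.lyapunov N = M * hM.lyapunov N * Mᵀ + N := by
  have h : hM.lyapunov N - M * hM.lyapunov N * Mᵀ = N :=
    (LinearEquiv.ofInjectiveEndo (lyapunovMap M) hM.lyapunovMap_injective).apply_symm_apply N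
  exact (sub_eq_iff_eq_add'.1 h)

theorem SchurStable.eq_lyapunov (hM : SchurStable M) (hX : X = M * X * Mᵀ + N) :
    X = hM.lyapunov N :=
  hM.lyapunov_unique hX (hM.lyapunov_eq N)

theorem Matrix.PosSemidef.mul_mul_transpose_real {n m : ℕ} {X : Matrix (Fin n) (Fin n) ℝ}
    (hX : X.PosSemidef) (B : Matrix (Fin m) (Fin n) ℝ) : (B * X * Bᵀ).PosSemidef := by
  simpa [Matrix.conjTranspose_eq_transpose_of_trivial] using hX.mul_mul_conjTranspose_same B

theorem isClosed_setOf_posSemidef_real :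
    IsClosed {X : Matrix (Fin n) (Fin n) ℝ | X.PosSemidef} := by
  have : {X : Matrix (Fin n) (Fin n) ℝ | X.PosSemidef} =
      {X | Xᵀ = X} ∩ ⋂ v : Fin n → ℝ, {X | 0 ≤ v ⬝ᵥ X *ᵥ v} := by
    ext X
    simp [Matrix.posSemidef_iff_dotProduct_mulVec, Matrix.IsHermitian,
      Matrix.conjTranspose_eq_transpose_of_trivial]
  rw [this]
  refine (isClosed_eq (by fun_prop) continuous_id).inter (isClosed_iInter fun v => ?_)
  exact isClosed_le continuous_const (by fun_prop)

/-- The solution is the limit of the recursion started at `0`, which stays in the closed positive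
semidefinite cone. -/
theorem SchurStable.lyapunov_posSemidef (hM : SchurStable M) (hN : N.PosSemidef) :
    (hM.lyapunov N).PosSemidef := by
  let P : ℕ → Matrix (Fin n) (Fin n) ℝ := fun t =>
    Nat.rec 0 (fun _ Y => M * Y * Mᵀ + N) t
  have hP : ∀ t, P (t + 1) = M * P t * Mᵀ + N := fun _ => rfl
  refine isClosed_setOf_posSemidef_real.mem_of_tendsto
    (hM.tendsto_of_recursion hP (hM.lyapunov_eq N)) (Eventually.of_forall fun t => ?_)
  induction t with
  | zero => exact Matrix.PosSemidef.zero
  | succ t ih => exact (ih.mul_mul_transpose_real M).add hN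

theorem SchurStable.le_lyapunov (hM : SchurStable M) (hN : N.PosSemidef) :
    (hM.lyapunov N - N).PosSemidef := by
  have h : hM.lyapunov N - N = M * hM.lyapunov N * Mᵀ := sub_eq_iff_eq_add.2 (hM.lyapunov_eq N)
  rw [h]
  exact (hM.lyapunov_posSemidef hN).mul_mul_transpose_real M

/-- Evaluate the quadratic form at `e_i ± e_j`. A trace bound thus bounds every entry, which is the
source of compactness below. -/
theorem Matrix.PosSemidef.abs_apply_le_trace (hX : X.PosSemidef) (i j : Fin n) :
    |X i j| ≤ X.trace := by
  have hsymm : X j i = X i j := by simpa using hX.isHermitian.apply i j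
  have hq : ∀ c : ℝ, 0 ≤ X i i + 2 * c * X i j + c ^ 2 * X j j := by
    intro c
    have := hX.dotProduct_mulVec_nonneg (Pi.single i 1 + c • Pi.single j 1)
    simp [Matrix.mulVec_add, Matrix.mulVec_smul, hsymm] at this
    nlinarith
  have hd : ∀ k, 0 ≤ X k k := fun k => hX.diag_nonneg
  have hle : ∀ k, X k k ≤ X.trace := fun k =>
    Finset.single_le_sum (f := fun k => X k k) (fun k _ => hd k) (Finset.mem_univ k)
  have h1 := hq 1
  have h2 := hq (-1)
  have := hle i
  have := hle j
  rw [abs_le]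
  constructor <;> nlinarith

theorem Matrix.PosSemidef.eq_zero_of_trace_real (hX : X.PosSemidef) (h : X.trace ≤ 0) : X = 0 := by
  ext i j
  have := hX.abs_apply_le_trace i j
  have := abs_nonneg (X i j)
  exact abs_eq_zero.1 (by linarith)

theorem isCompact_setOf_posSemidef_trace_le (B : ℝ) :
    IsCompact {X : Matrix (Fin n) (Fin n) ℝ | X.PosSemidef ∧ X.trace ≤ B} := by
  have hK : IsCompact (Set.univ.pi fun _ : Fin n => Set.univ.pi fun _ : Fin n =>
      Set.Icc (-B) B : Set (Fin n → Fin n → ℝ)) :=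
    isCompact_univ_pi fun _ => isCompact_univ_pi fun _ => isCompact_Icc
  refine IsCompact.of_isClosed_subset (X := Matrix (Fin n) (Fin n) ℝ) hK ?_ ?_
  · exact isClosed_setOf_posSemidef_real.inter (isClosed_le continuous_id.matrix_trace continuous_const)
  · rintro X ⟨hX, hB⟩ i - j -
    have := (hX.abs_apply_le_trace i j).trans hB
    exact abs_le.1 this

/-- A bounded family of positive semidefinite matrices tends to `Y` if all its limits along
finer filters are equal to `Y`. -/
theorem tendsto_of_posSemidef_of_trace_le {ι : Type*} {l : Filter ι}
    {P : ι → Matrix (Fin n) (Fin n) ℝ} {Y : Matrix (Fin n) (Fin n) ℝ} {B : ℝ}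
    (hP : ∀ᶠ t in l, (P t).PosSemidef) (hB : ∀ᶠ t in l, (P t).trace ≤ B)
    (h : ∀ Z (l' : Filter ι), l' ≤ l → l'.NeBot → Z.PosSemidef → Tendsto P l' (𝓝 Z) → Z = Y) :
    Tendsto P l (𝓝 Y) := by
  refine (isCompact_setOf_posSemidef_trace_le (n := n) B).tendsto_nhds_of_unique_mapClusterPt
    (hP.and hB) fun Z hZ hc => ?_
  obtain ⟨F, hF, hle⟩ := mapClusterPt_iff_ultrafilter.1 hc
  exact h Z F hF inferInstance hZ.1 hle

end Lyapunov

/-! ### The Riccati equation: existence, uniqueness, stabilizing gain, optimality, continuity. -/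

section Riccati

variable {n m : ℕ} {A : Matrix (Fin n) (Fin n) ℝ} {C : Matrix (Fin m) (Fin n) ℝ}
  {V X Y : Matrix (Fin n) (Fin n) ℝ} {W : Matrix (Fin m) (Fin m) ℝ}

theorem Matrix.PosSemidef.transpose_eq_real (hX : X.PosSemidef) : Xᵀ = X := by
  simpa [Matrix.conjTranspose_eq_transpose_of_trivial] using hX.isHermitian.eq

theorem Matrix.PosSemidef.eq_of_sub_of_sub (h : (X - Y).PosSemidef) (h' : (Y - X).PosSemidef) :
    X = Y := by
  refine sub_eq_zero.1 (h.eq_zero_of_trace_real ?_)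
  have := h'.trace_nonneg
  rw [Matrix.trace_sub] at this ⊢
  linarith

theorem Matrix.PosDef.eq_zero_of_trace_mul_mul_transpose {S : Matrix (Fin m) (Fin m) ℝ}
    (hS : S.PosDef) {B : Matrix (Fin n) (Fin m) ℝ} (h : (B * S * Bᵀ).trace ≤ 0) : B = 0 := by
  have h0 := (hS.posSemidef.mul_mul_transpose_real B).eq_zero_of_trace_real h
  ext i j
  have h1 : B i ⬝ᵥ S *ᵥ B i = 0 := by
    have := congrFun (congrFun h0 i) i
    rw [Matrix.mul_assoc] at this
    exact this
  by_contra hne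
  have hB : B i ≠ 0 := fun hB => hne (congrFun hB j)
  have := hS.dotProduct_mulVec_pos hB
  simp at this
  linarith

/-- The covariance `(1 - K C) V (1 - K C)ᵀ + K W Kᵀ` of the noise which enters the estimation error
in one step of the filter with gain `K`. -/
noncomputable def filterNoise (C : Matrix (Fin m) (Fin n) ℝ) (V : Matrix (Fin n) (Fin n) ℝ)
    (W : Matrix (Fin m) (Fin m) ℝ) (K : Matrix (Fin n) (Fin m) ℝ) : Matrix (Fin n) (Fin n) ℝ :=
  (1 - K * C) * V * (1 - K * C)ᵀ + K * W * Kᵀ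

theorem filterNoise_posSemidef (hV : V.PosSemidef) (hW : W.PosSemidef)
    (K : Matrix (Fin n) (Fin m) ℝ) : (filterNoise C V W K).PosSemidef :=
  (hV.mul_mul_transpose_real _).add (hW.mul_mul_transpose_real _)

theorem innovationCov_posDef (hX : X.PosSemidef) (hW : W.PosDef) :
    (C * X * Cᵀ + W).PosDef :=
  Matrix.PosDef.posSemidef_add (hX.mul_mul_transpose_real C) hW

theorem gainOf_mul (hX : X.PosSemidef) (hW : W.PosDef) :
    gainOf C W X * (C * X * Cᵀ + W) = X * Cᵀ := by
  rw [gainOf, Matrix.nonsing_inv_mul_cancel_right]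
  exact (Matrix.isUnit_iff_isUnit_det _).1 (innovationCov_posDef hX hW).isUnit

theorem eq_gainOf (hX : X.PosSemidef) (hW : W.PosDef) {K : Matrix (Fin n) (Fin m) ℝ}
    (h : K * (C * X * Cᵀ + W) = X * Cᵀ) : K = gainOf C W X := by
  rw [gainOf, ← h, Matrix.mul_nonsing_inv_cancel_right]
  exact (Matrix.isUnit_iff_isUnit_det _).1 (innovationCov_posDef hX hW).isUnit

/-- Completion of squares. -/
theorem joseph_form (hX : X.PosSemidef) (hW : W.PosDef) (K : Matrix (Fin n) (Fin m) ℝ) :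
    filterNoise C X W K = (X - gainOf C W X * C * X) +
      (K - gainOf C W X) * (C * X * Cᵀ + W) * (K - gainOf C W X)ᵀ := by
  have h1 := gainOf_mul (C := C) hX hW
  set G := gainOf C W X
  have h2 : (C * X * Cᵀ + W) * Gᵀ = C * X := by
    have := congrArg Matrix.transpose h1
    rwa [Matrix.transpose_mul, (innovationCov_posDef hX hW).posSemidef.transpose_eq_real,
      Matrix.transpose_mul, Matrix.transpose_transpose, hX.transpose_eq_real] at this
  calc filterNoise C X W K
      = X - K * (C * X) - (X * Cᵀ) * Kᵀ + K * (C * X * Cᵀ + W) * Kᵀ := by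
        simp only [filterNoise, Matrix.transpose_sub, Matrix.transpose_mul, Matrix.transpose_one,
          Matrix.mul_add, Matrix.add_mul, Matrix.mul_sub, Matrix.sub_mul, Matrix.one_mul,
          Matrix.mul_one, Matrix.mul_assoc]
        abel
    _ = X - G * (C * X) + (K * (C * X * Cᵀ + W) * Kᵀ - K * (C * X) - (X * Cᵀ) * Kᵀ
          + G * (C * X)) := by abel
    _ = X - G * (C * X) + (K * (C * X * Cᵀ + W) * Kᵀ - K * ((C * X * Cᵀ + W) * Gᵀ)
          - (G * (C * X * Cᵀ + W)) * Kᵀ + G * ((C * X * Cᵀ + W) * Gᵀ)) := by rw [h2, h1]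
    _ = _ := by
        simp only [Matrix.transpose_sub, Matrix.mul_sub, Matrix.sub_mul, Matrix.mul_assoc]
        abel

theorem filterNoise_gainOf (hX : X.PosSemidef) (hW : W.PosDef) :
    filterNoise C X W (gainOf C W X) = X - gainOf C W X * C * X := by
  simp [joseph_form hX hW]

theorem riccatiMap_eq (V : Matrix (Fin n) (Fin n) ℝ) (hX : X.PosSemidef) (hW : W.PosDef) :
    riccatiMap A C V W X = A * filterNoise C X W (gainOf C W X) * Aᵀ + V := by
  rw [filterNoise_gainOf hX hW, riccatiMap, gainOf]
  simp only [Matrix.mul_sub, Matrix.sub_mul, Matrix.mul_assoc]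

theorem riccatiMap_posSemidef (hV : V.PosSemidef) (hX : X.PosSemidef) (hW : W.PosDef) :
    (riccatiMap A C V W X).PosSemidef := by
  rw [riccatiMap_eq V hX hW]
  exact ((filterNoise_posSemidef hX hW.posSemidef _).mul_mul_transpose_real A).add hV

/-- The gain of `Y` is suboptimal for `X`, with excess `D ≥ 0`; with this gain fixed for both, the
covariance is linear in the prior covariance and hence monotone. -/
theorem riccatiMap_mono (hX : X.PosSemidef) (hY : Y.PosSemidef) (hW : W.PosDef)
    (h : (Y - X).PosSemidef) : (riccatiMap A C V W Y - riccatiMap A C V W X).PosSemidef := by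
  have h1 := joseph_form (C := C) hX hW (gainOf C W Y)
  set D := (gainOf C W Y - gainOf C W X) * (C * X * Cᵀ + W) * (gainOf C W Y - gainOf C W X)ᵀ
  have h2 : riccatiMap A C V W Y - riccatiMap A C V W X =
      A * ((1 - gainOf C W Y * C) * (Y - X) * (1 - gainOf C W Y * C)ᵀ + D) * Aᵀ := by
    rw [riccatiMap_eq V hX hW, riccatiMap_eq V hY hW, filterNoise_gainOf hX hW,
      eq_sub_of_add_eq h1.symm]
    simp only [filterNoise]
    generalize 1 - gainOf C W Y * C = F
    simp only [Matrix.mul_sub, Matrix.sub_mul, Matrix.mul_add, Matrix.add_mul]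
    abel
  rw [h2]
  exact ((h.mul_mul_transpose_real _).add
    ((innovationCov_posDef hX hW).posSemidef.mul_mul_transpose_real _)).mul_mul_transpose_real A

/-- Comparison of the optimal gain with the gain `0`. -/
theorem riccatiMap_le (hX : X.PosSemidef) (hW : W.PosDef) :
    (A * X * Aᵀ + V - riccatiMap A C V W X).PosSemidef := by
  have h1 := joseph_form (C := C) hX hW 0
  set D := (0 - gainOf C W X) * (C * X * Cᵀ + W) * (0 - gainOf C W X)ᵀ
  have h2 : A * X * Aᵀ + V - riccatiMap A C V W X = A * D * Aᵀ := by
    rw [riccatiMap_eq V hX hW, filterNoise_gainOf hX hW, eq_sub_of_add_eq h1.symm]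
    simp [filterNoise, Matrix.mul_sub, Matrix.sub_mul]
  rw [h2]
  exact ((innovationCov_posDef hX hW).posSemidef.mul_mul_transpose_real _).mul_mul_transpose_real A

theorem tendsto_gainOf {ι : Type*} {l : Filter ι} {Xs : ι → Matrix (Fin n) (Fin n) ℝ}
    {Ws : ι → Matrix (Fin m) (Fin m) ℝ} (hX : X.PosSemidef) (hW : W.PosDef)
    (hXs : Tendsto Xs l (𝓝 X)) (hWs : Tendsto Ws l (𝓝 W)) :
    Tendsto (fun t => gainOf C (Ws t) (Xs t)) l (𝓝 (gainOf C W X)) := by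
  have hdet : (C * X * Cᵀ + W).det ≠ 0 := by
    have := (Matrix.isUnit_iff_isUnit_det _).1 (innovationCov_posDef (C := C) hX hW).isUnit
    exact this.ne_zero
  have hinv : ContinuousAt Inv.inv (C * X * Cᵀ + W) := by
    refine continuousAt_matrix_inv _ ?_
    rw [Ring.inverse_eq_inv']
    exact continuousAt_inv₀ hdet
  have h1 : Tendsto (fun t => C * Xs t * Cᵀ + Ws t) l (𝓝 (C * X * Cᵀ + W)) := by
    have hc : Continuous fun p : Matrix (Fin n) (Fin n) ℝ × Matrix (Fin m) (Fin m) ℝ =>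
      C * p.1 * Cᵀ + p.2 := by fun_prop
    have h := (hc.tendsto (X, W)).comp (hXs.prodMk_nhds hWs)
    simpa only [Function.comp_def] using h
  have h2 := hinv.tendsto.comp h1
  have hc : Continuous fun p : Matrix (Fin n) (Fin n) ℝ × Matrix (Fin m) (Fin m) ℝ =>
      p.1 * Cᵀ * p.2 := by fun_prop
  have h3 := (hc.tendsto (X, (C * X * Cᵀ + W)⁻¹)).comp (hXs.prodMk_nhds h2)
  simpa only [Function.comp_def, gainOf] using h3

theorem tendsto_riccatiMap {ι : Type*} {l : Filter ι} {Xs Vs : ι → Matrix (Fin n) (Fin n) ℝ}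
    {Ws : ι → Matrix (Fin m) (Fin m) ℝ} (hX : X.PosSemidef) (hW : W.PosDef)
    (hXs : Tendsto Xs l (𝓝 X)) (hVs : Tendsto Vs l (𝓝 V)) (hWs : Tendsto Ws l (𝓝 W)) :
    Tendsto (fun t => riccatiMap A C (Vs t) (Ws t) (Xs t)) l (𝓝 (riccatiMap A C V W X)) := by
  have h1 := tendsto_gainOf (C := C) hX hW hXs hWs
  have hc : Continuous fun p : Matrix (Fin n) (Fin n) ℝ × Matrix (Fin n) (Fin n) ℝ ×
      Matrix (Fin n) (Fin m) ℝ => A * p.1 * Aᵀ - A * p.2.2 * C * p.1 * Aᵀ + p.2.1 := by fun_prop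
  have := (hc.tendsto (X, V, gainOf C W X)).comp (hXs.prodMk_nhds (hVs.prodMk_nhds h1))
  simpa [Function.comp_def, riccatiMap, gainOf, Matrix.mul_assoc] using this

/-- The iterates of the Riccati map from `0` increase and stay below the open-loop covariance
`hA.lyapunov V`, so they converge, and the limit is a fixed point by continuity. -/
theorem exists_isRiccatiSolution (hA : SchurStable A) (hV : V.PosSemidef) (hW : W.PosDef) :
    ∃ X, IsRiccatiSolution A C V W X := by
  let Z : ℕ → Matrix (Fin n) (Fin n) ℝ := fun t => (riccatiMap A C V W)^[t] 0
  have hZ : ∀ t, Z (t + 1) = riccatiMap A C V W (Z t) := fun t =>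
    Function.iterate_succ_apply' _ _ _
  have hpos : ∀ t, (Z t).PosSemidef := by
    intro t
    induction t with
    | zero => exact Matrix.PosSemidef.zero
    | succ t ih => rw [hZ]; exact riccatiMap_posSemidef hV ih hW
  have hstep : ∀ t, (Z (t + 1) - Z t).PosSemidef := by
    intro t
    induction t with
    | zero => simpa [Z] using hpos 1
    | succ t ih =>
      rw [hZ (t + 1), hZ t]
      exact riccatiMap_mono (hpos t) (hZ t ▸ hpos (t + 1)) hW (hZ t ▸ ih)
  have hmono : ∀ j t, j ≤ t → (Z t - Z j).PosSemidef := by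
    intro j t h
    induction t, h using Nat.le_induction with
    | base => simpa using Matrix.PosSemidef.zero
    | succ t _ ih => simpa using (hstep t).add ih
  have hbound : ∀ t, (hA.lyapunov V - Z t).PosSemidef := by
    intro t
    induction t with
    | zero => simpa [Z] using hA.lyapunov_posSemidef hV
    | succ t ih =>
      have := (ih.mul_mul_transpose_real A).add
        (riccatiMap_le (A := A) (C := C) (V := V) (hpos t) hW)
      rw [← hZ] at this
      convert this using 1
      nth_rw 1 [hA.lyapunov_eq V]
      simp only [Matrix.mul_sub, Matrix.sub_mul]
      abel
  have htr : ∀ t, (Z t).trace ≤ (hA.lyapunov V).trace := fun t => by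
    have := (hbound t).trace_nonneg
    rw [Matrix.trace_sub] at this
    linarith
  have hge : ∀ (Y : Matrix (Fin n) (Fin n) ℝ) (l : Filter ℕ), l ≤ atTop → l.NeBot →
      Tendsto Z l (𝓝 Y) → ∀ j, (Y - Z j).PosSemidef := by
    intro Y l hl _ hY j
    refine isClosed_setOf_posSemidef_real.mem_of_tendsto (hY.sub_const (Z j)) ?_
    filter_upwards [hl (eventually_ge_atTop j)] with t ht using hmono j t ht
  have hle : ∀ (Y Y' : Matrix (Fin n) (Fin n) ℝ) (l : Filter ℕ), l.NeBot →
      Tendsto Z l (𝓝 Y) → (∀ j, (Y' - Z j).PosSemidef) → (Y' - Y).PosSemidef := by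
    intro Y Y' l _ hY h
    exact isClosed_setOf_posSemidef_real.mem_of_tendsto (hY.const_sub Y') (Eventually.of_forall h)
  -- Compactness supplies one limit along an ultrafilter; by monotonicity any other limit point lies
  -- both above and below it.
  let U : Ultrafilter ℕ := Ultrafilter.of atTop
  have hU : (U : Filter ℕ) ≤ atTop := Ultrafilter.of_le atTop
  obtain ⟨Y, ⟨hY, -⟩, hYU⟩ := (isCompact_setOf_posSemidef_trace_le (n := n)
    (hA.lyapunov V).trace).ultrafilter_le_nhds (U.map Z)
    (by
      rw [le_principal_iff]
      change ∀ᶠ t in (U : Filter ℕ), Z t ∈ _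
      exact Eventually.of_forall fun t => ⟨hpos t, htr t⟩)
  have hYU' : Tendsto Z U (𝓝 Y) := hYU
  have hlim : Tendsto Z atTop (𝓝 Y) := by
    refine tendsto_of_posSemidef_of_trace_le (Eventually.of_forall hpos) (Eventually.of_forall htr)
      fun Y' l hl hne _ hY' => ?_
    exact Matrix.PosSemidef.eq_of_sub_of_sub
      (hle Y Y' U inferInstance hYU' (hge Y' l hl hne hY'))
      (hle Y' Y l hne hY' (hge Y U hU inferInstance hYU'))
  refine ⟨Y, hY, tendsto_nhds_unique ((tendsto_add_atTop_iff_nat 1).2 hlim) ?_⟩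
  simp only [hZ]
  exact tendsto_riccatiMap hY hW hlim tendsto_const_nhds tendsto_const_nhds

/-- A left eigenvector for an eigenvalue outside the open unit disc is not seen by the right-hand
side of the Lyapunov equation. -/
theorem quadForm_eq_zero_of_lyapunov {M P N : Matrix (Fin n) (Fin n) ℝ} (hP : P.PosSemidef)
    (hN : N.PosSemidef) (h : P = M * P * Mᵀ + N) {μ : ℂ} {u v : Fin n → ℝ} (hμ : 1 ≤ ‖μ‖)
    (hu : u ᵥ* M = μ.re • u - μ.im • v) (hv : v ᵥ* M = μ.im • u + μ.re • v) :
    u ⬝ᵥ N *ᵥ u = 0 ∧ v ⬝ᵥ N *ᵥ v = 0 := by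
  have hq : ∀ x : Fin n → ℝ, x ⬝ᵥ P *ᵥ x = (x ᵥ* M) ⬝ᵥ P *ᵥ (x ᵥ* M) + x ⬝ᵥ N *ᵥ x := by
    intro x
    nth_rw 1 [h]
    rw [Matrix.add_mulVec, dotProduct_add, ← Matrix.mulVec_mulVec, ← Matrix.mulVec_mulVec,
      Matrix.dotProduct_mulVec x M, Matrix.mulVec_transpose]
  have h1 := hq u
  have h2 := hq v
  rw [hu] at h1
  rw [hv] at h2
  simp only [Matrix.mulVec_add, Matrix.mulVec_sub, Matrix.mulVec_smul, dotProduct_add,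
    dotProduct_sub, add_dotProduct, sub_dotProduct, smul_dotProduct, dotProduct_smul,
    smul_eq_mul] at h1 h2
  have hnu := hN.dotProduct_mulVec_nonneg u
  have hnv := hN.dotProduct_mulVec_nonneg v
  have hpu := hP.dotProduct_mulVec_nonneg u
  have hpv := hP.dotProduct_mulVec_nonneg v
  simp only [star_trivial] at hnu hnv hpu hpv
  have hμ2 : 1 ≤ μ.re ^ 2 + μ.im ^ 2 := by
    have : 1 ≤ ‖μ‖ ^ 2 := by nlinarith
    rwa [Complex.sq_norm, Complex.normSq_apply, ← sq, ← sq] at this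
  -- For the eigenvector `z = u + iv` the mixed terms in `u` and `v` cancel in the sum, leaving the
  -- factor `|μ|²` on the form of `P`.
  have h3 : u ⬝ᵥ N *ᵥ u + v ⬝ᵥ N *ᵥ v =
      -(μ.re ^ 2 + μ.im ^ 2 - 1) * (u ⬝ᵥ P *ᵥ u + v ⬝ᵥ P *ᵥ v) := by linear_combination -h1 - h2
  have h4 : 0 ≤ (μ.re ^ 2 + μ.im ^ 2 - 1) * (u ⬝ᵥ P *ᵥ u + v ⬝ᵥ P *ᵥ v) :=
    mul_nonneg (by linarith) (by linarith)
  constructor <;> linarith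

theorem vecMul_map_ofReal (z : Fin n → ℂ) (M : Matrix (Fin n) (Fin m) ℝ) (j : Fin m) :
    (z ᵥ* M.map (algebraMap ℝ ℂ)) j =
      ⟨((fun i => (z i).re) ᵥ* M) j, ((fun i => (z i).im) ᵥ* M) j⟩ := by
  apply Complex.ext <;> simp [Matrix.vecMul, dotProduct]

theorem vecMul_map_ofReal_eq_smul_iff (z : Fin n → ℂ) (μ : ℂ) (M : Matrix (Fin n) (Fin n) ℝ) :
    z ᵥ* M.map (algebraMap ℝ ℂ) = μ • z ↔
      (fun i => (z i).re) ᵥ* M = μ.re • (fun i => (z i).re) - μ.im • (fun i => (z i).im) ∧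
      (fun i => (z i).im) ᵥ* M = μ.im • (fun i => (z i).re) + μ.re • (fun i => (z i).im) := by
  simp only [funext_iff, vecMul_map_ofReal, Complex.ext_iff]
  simp [forall_and, add_comm]

theorem Matrix.PosDef.vecMul_eq_zero (hW : W.PosDef) {K : Matrix (Fin n) (Fin m) ℝ}
    (hV : V.PosSemidef) {u : Fin n → ℝ} (h : u ⬝ᵥ filterNoise C V W K *ᵥ u = 0) :
    u ᵥ* K = 0 := by
  by_contra hne
  have h1 := hW.dotProduct_mulVec_pos hne
  have h2 := (hV.mul_mul_transpose_real (1 - K * C)).dotProduct_mulVec_nonneg u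
  rw [filterNoise, Matrix.add_mulVec, dotProduct_add, ← Matrix.mulVec_mulVec u (K * W),
    ← Matrix.mulVec_mulVec _ K, Matrix.dotProduct_mulVec u K, Matrix.mulVec_transpose] at h
  simp only [star_trivial] at h1 h2
  linarith

theorem IsRiccatiSolution.eq_step (hX : IsRiccatiSolution A C V W X) (hW : W.PosDef) :
    X = A * filterNoise C X W (gainOf C W X) * Aᵀ + V := by
  rw [← riccatiMap_eq V hX.1 hW]
  exact hX.2

/-- Passes between the two forms of the problem: the prediction covariance `A P Aᵀ + V` of the
Riccati equation and the filtered covariance `P` of the Lyapunov equation. -/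
theorem filterNoise_step (P : Matrix (Fin n) (Fin n) ℝ) (K : Matrix (Fin n) (Fin m) ℝ) :
    filterNoise C (A * P * Aᵀ + V) W K =
      (A - K * C * A) * P * (A - K * C * A)ᵀ + filterNoise C V W K := by
  have h : A - K * C * A = (1 - K * C) * A := by rw [Matrix.sub_mul, Matrix.one_mul]
  rw [h, filterNoise, filterNoise, Matrix.transpose_mul]
  simp only [Matrix.mul_add, Matrix.add_mul, Matrix.mul_assoc, add_assoc]

theorem IsRiccatiSolution.lyapunov_eq (hX : IsRiccatiSolution A C V W X) (hW : W.PosDef) :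
    filterNoise C X W (gainOf C W X) =
      (A - gainOf C W X * C * A) * filterNoise C X W (gainOf C W X) *
        (A - gainOf C W X * C * A)ᵀ + filterNoise C V W (gainOf C W X) := by
  rw [← filterNoise_step, ← hX.eq_step hW]

/-- A left eigenvector with `|μ| ≥ 1` annihilates the noise covariance; as `W > 0`, it annihilates
the gain. It is then a left eigenvector of `A` for the same `μ`, which contradicts stability of `A`
unless it is zero. -/
theorem IsRiccatiSolution.schurStable (hX : IsRiccatiSolution A C V W X) (hA : SchurStable A)
    (hV : V.PosSemidef) (hW : W.PosDef) : SchurStable (A - gainOf C W X * C * A) := by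
  refine schurStable_of_forall_vecMul fun μ z hz hμ => ?_
  obtain ⟨hu, hv⟩ := (vecMul_map_ofReal_eq_smul_iff _ _ _).1 hz
  obtain ⟨hu0, hv0⟩ := quadForm_eq_zero_of_lyapunov
    (filterNoise_posSemidef hX.1 hW.posSemidef _) (filterNoise_posSemidef hV hW.posSemidef _)
    (hX.lyapunov_eq hW) hμ hu hv
  have hu1 := hW.vecMul_eq_zero hV hu0
  have hv1 := hW.vecMul_eq_zero hV hv0
  refine hA.eq_zero_of_vecMul ((vecMul_map_ofReal_eq_smul_iff _ _ _).2 ⟨?_, ?_⟩) hμ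
  · rw [← hu, Matrix.vecMul_sub, Matrix.mul_assoc, ← Matrix.vecMul_vecMul, hu1]
    simp
  · rw [← hv, Matrix.vecMul_sub, Matrix.mul_assoc, ← Matrix.vecMul_vecMul, hv1]
    simp

/-- The excess of the error covariance of the gain `K` over that of the optimal gain. -/
theorem IsRiccatiSolution.lyapunov_sub (hX : IsRiccatiSolution A C V W X) (hW : W.PosDef)
    {K : Matrix (Fin n) (Fin m) ℝ} (hK : SchurStable (A - K * C * A)) :
    hK.lyapunov (filterNoise C V W K) = filterNoise C X W (gainOf C W X) +
      hK.lyapunov ((K - gainOf C W X) * (C * X * Cᵀ + W) * (K - gainOf C W X)ᵀ) := by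
  set G := gainOf C W X
  set D := (K - G) * (C * X * Cᵀ + W) * (K - G)ᵀ
  have h1 : filterNoise C X W G + D =
      (A - K * C * A) * filterNoise C X W G * (A - K * C * A)ᵀ + filterNoise C V W K := by
    rw [← filterNoise_step, ← hX.eq_step hW, joseph_form hX.1 hW K, filterNoise_gainOf hX.1 hW]
  refine (hK.eq_lyapunov ?_).symm
  calc filterNoise C X W G + hK.lyapunov D
      = (filterNoise C X W G + D) + (A - K * C * A) * hK.lyapunov D * (A - K * C * A)ᵀ := by
        nth_rw 1 [hK.lyapunov_eq D]
        abel
    _ = _ := by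
        rw [h1]
        simp only [Matrix.mul_add, Matrix.add_mul]
        abel

theorem IsRiccatiSolution.lyapunov_gainOf (hX : IsRiccatiSolution A C V W X) (hW : W.PosDef)
    (hG : SchurStable (A - gainOf C W X * C * A)) :
    hG.lyapunov (filterNoise C V W (gainOf C W X)) = filterNoise C X W (gainOf C W X) := by
  rw [hX.lyapunov_sub hW hG]
  simp

theorem IsRiccatiSolution.lyapunov_sub_posSemidef (hX : IsRiccatiSolution A C V W X)
    (hW : W.PosDef) {K : Matrix (Fin n) (Fin m) ℝ} (hK : SchurStable (A - K * C * A)) :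
    (hK.lyapunov (filterNoise C V W K) - filterNoise C X W (gainOf C W X)).PosSemidef := by
  rw [hX.lyapunov_sub hW hK, add_sub_cancel_left]
  exact hK.lyapunov_posSemidef
    ((innovationCov_posDef hX.1 hW).posSemidef.mul_mul_transpose_real _)

/-- The excess `L_K(D)` dominates `D` itself, and `tr D ≤ 0` forces `K` to be the Riccati gain
because the innovation covariance is positive definite. -/
theorem IsRiccatiSolution.trace_lt (hX : IsRiccatiSolution A C V W X) (hW : W.PosDef)
    {K : Matrix (Fin n) (Fin m) ℝ} (hK : SchurStable (A - K * C * A)) (hne : K ≠ gainOf C W X) :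
    (filterNoise C X W (gainOf C W X)).trace < (hK.lyapunov (filterNoise C V W K)).trace := by
  rw [hX.lyapunov_sub hW hK, Matrix.trace_add, lt_add_iff_pos_right]
  have hS := innovationCov_posDef (C := C) hX.1 hW
  have h1 := (hK.le_lyapunov (hS.posSemidef.mul_mul_transpose_real
    (K - gainOf C W X))).trace_nonneg
  rw [Matrix.trace_sub] at h1
  by_contra hle
  exact hne (sub_eq_zero.1 (hS.eq_zero_of_trace_mul_mul_transpose (by linarith)))

/-- Both gains are stabilizing, so each filtered covariance is at most the other; the Riccati step
recovers `X` from the filtered covariance. -/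
theorem IsRiccatiSolution.unique (hA : SchurStable A) (hV : V.PosSemidef) (hW : W.PosDef)
    (hX : IsRiccatiSolution A C V W X) (hY : IsRiccatiSolution A C V W Y) : X = Y := by
  have h1 := hY.lyapunov_sub_posSemidef hW (hX.schurStable hA hV hW)
  have h2 := hX.lyapunov_sub_posSemidef hW (hY.schurStable hA hV hW)
  rw [hX.lyapunov_gainOf hW] at h1
  rw [hY.lyapunov_gainOf hW] at h2
  rw [hX.eq_step hW, hY.eq_step hW, Matrix.PosSemidef.eq_of_sub_of_sub h1 h2]

theorem riccatiSolution_spec (hA : SchurStable A) (hV : V.PosSemidef) (hW : W.PosDef) :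
    IsRiccatiSolution A C V W (riccatiSolution A C V W) :=
  Classical.epsilon_spec (exists_isRiccatiSolution hA hV hW)

theorem IsRiccatiSolution.le_lyapunov (hX : IsRiccatiSolution A C V W X) (hA : SchurStable A)
    (hW : W.PosDef) : (hA.lyapunov V - X).PosSemidef := by
  have h := riccatiMap_le (A := A) (C := C) (V := V) hX.1 hW
  rw [← hX.2] at h
  have h2 : hA.lyapunov V - X = hA.lyapunov (A * X * Aᵀ + V - X) := by
    refine hA.eq_lyapunov ?_
    nth_rw 1 [hA.lyapunov_eq V]
    simp only [Matrix.mul_sub, Matrix.sub_mul]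
    abel
  rw [h2]
  exact hA.lyapunov_posSemidef h

/-- The open-loop covariances bound the solutions uniformly, and every limit point solves the
limiting equation, whose solution is unique. -/
theorem tendsto_riccatiSolution {ι : Type*} {l : Filter ι} {Vs : ι → Matrix (Fin n) (Fin n) ℝ}
    {Ws : ι → Matrix (Fin m) (Fin m) ℝ} (hA : SchurStable A) (hV : V.PosSemidef) (hW : W.PosDef)
    (hVs : Tendsto Vs l (𝓝 V)) (hWs : Tendsto Ws l (𝓝 W)) (hVs0 : ∀ᶠ t in l, (Vs t).PosSemidef)
    (hWs0 : ∀ᶠ t in l, (Ws t).PosDef) :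
    Tendsto (fun t => riccatiSolution A C (Vs t) (Ws t)) l (𝓝 (riccatiSolution A C V W)) := by
  have hsol : ∀ᶠ t in l, IsRiccatiSolution A C (Vs t) (Ws t)
      (riccatiSolution A C (Vs t) (Ws t)) := by
    filter_upwards [hVs0, hWs0] with t h1 h2 using riccatiSolution_spec hA h1 h2
  have hlin : Continuous fun N => (hA.lyapunov N).trace :=
    LinearMap.continuous_of_finiteDimensional ((Matrix.traceLinearMap (Fin n) ℝ ℝ) ∘ₗ hA.lyapunov)
  have hb := ((hlin.tendsto V).comp hVs).eventually
    (eventually_le_nhds (lt_add_one (hA.lyapunov V).trace))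
  refine tendsto_of_posSemidef_of_trace_le (B := (hA.lyapunov V).trace + 1)
    (hsol.mono fun t h => h.1) ?_ fun Z l' hl' hne hZ hlim => ?_
  · filter_upwards [hsol, hb, hWs0] with t h1 h2 h3
    have := (h1.le_lyapunov hA h3).trace_nonneg
    rw [Matrix.trace_sub] at this
    simp only [Function.comp_apply] at h2
    linarith
  · refine IsRiccatiSolution.unique hA hV hW ⟨hZ, ?_⟩ (riccatiSolution_spec hA hV hW)
    refine tendsto_nhds_unique hlim ?_
    refine (tendsto_riccatiMap hZ hW hlim (hVs.mono_left hl') (hWs.mono_left hl')).congr' ?_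
    filter_upwards [hl' hsol] with t h using h.2.symm

end Riccati

/-! ### Second moments of random vectors. -/

section Moments

variable {Ω : Type*} [MeasurableSpace Ω] {P : Measure Ω} {p q r : ℕ}

/-- The matrix `𝔼[f gᵀ]` of two random vectors. -/
noncomputable def crossMoment (P : Measure Ω) (f : Ω → Fin p → ℝ) (g : Ω → Fin q → ℝ) :
    Matrix (Fin p) (Fin q) ℝ :=
  Matrix.of fun i j => ∫ ω, f ω i * g ω j ∂P

/-- A random vector with square integrable entries. -/
def SqIntegrable (P : Measure Ω) (f : Ω → Fin p → ℝ) : Prop :=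
  ∀ i, MemLp (fun ω => f ω i) 2 P

theorem crossMoment_transpose (f : Ω → Fin p → ℝ) (g : Ω → Fin q → ℝ) :
    (crossMoment P f g)ᵀ = crossMoment P g f := by
  ext i j
  simp [crossMoment, mul_comm]

theorem SqIntegrable.add {f g : Ω → Fin p → ℝ} (hf : SqIntegrable P f) (hg : SqIntegrable P g) :
    SqIntegrable P fun ω => f ω + g ω := fun i => (hf i).add (hg i)

theorem SqIntegrable.mulVec {f : Ω → Fin p → ℝ} (hf : SqIntegrable P f)
    (B : Matrix (Fin q) (Fin p) ℝ) : SqIntegrable P fun ω => B *ᵥ f ω := fun i =>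
  memLp_finsetSum Finset.univ fun k _ => (hf k).const_mul (B i k)

theorem SqIntegrable.integrable_mul {f : Ω → Fin p → ℝ} {g : Ω → Fin q → ℝ}
    (hf : SqIntegrable P f) (hg : SqIntegrable P g) (i : Fin p) (j : Fin q) :
    Integrable (fun ω => f ω i * g ω j) P :=
  (hf i).integrable_mul (hg j)

theorem crossMoment_add_left {f f' : Ω → Fin p → ℝ} {g : Ω → Fin q → ℝ} (hf : SqIntegrable P f)
    (hf' : SqIntegrable P f') (hg : SqIntegrable P g) :
    crossMoment P (fun ω => f ω + f' ω) g = crossMoment P f g + crossMoment P f' g := by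
  ext i j
  simp only [crossMoment, Matrix.of_apply, Matrix.add_apply, Pi.add_apply, add_mul]
  exact integral_add (hf.integrable_mul hg i j) (hf'.integrable_mul hg i j)

theorem crossMoment_mulVec_left {f : Ω → Fin p → ℝ} {g : Ω → Fin q → ℝ} (hf : SqIntegrable P f)
    (hg : SqIntegrable P g) (B : Matrix (Fin r) (Fin p) ℝ) :
    crossMoment P (fun ω => B *ᵥ f ω) g = B * crossMoment P f g := by
  ext i j
  simp only [crossMoment, Matrix.of_apply, Matrix.mul_apply, Matrix.mulVec, dotProduct,
    Finset.sum_mul, mul_assoc]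
  rw [integral_finsetSum _ fun k _ => (hf.integrable_mul hg k j).const_mul (B i k)]
  simp only [integral_const_mul]

theorem crossMoment_add_right {f : Ω → Fin p → ℝ} {g g' : Ω → Fin q → ℝ} (hf : SqIntegrable P f)
    (hg : SqIntegrable P g) (hg' : SqIntegrable P g') :
    crossMoment P f (fun ω => g ω + g' ω) = crossMoment P f g + crossMoment P f g' := by
  rw [← crossMoment_transpose, crossMoment_add_left hg hg' hf, Matrix.transpose_add,
    crossMoment_transpose, crossMoment_transpose]

theorem crossMoment_mulVec_right {f : Ω → Fin p → ℝ} {g : Ω → Fin q → ℝ} (hf : SqIntegrable P f)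
    (hg : SqIntegrable P g) (B : Matrix (Fin r) (Fin q) ℝ) :
    crossMoment P f (fun ω => B *ᵥ g ω) = crossMoment P f g * Bᵀ := by
  rw [← crossMoment_transpose, crossMoment_mulVec_left hg hf, Matrix.transpose_mul,
    crossMoment_transpose]

theorem crossMoment_eq_zero_comm {f : Ω → Fin p → ℝ} {g : Ω → Fin q → ℝ}
    (h : crossMoment P f g = 0) : crossMoment P g f = 0 := by
  rw [← crossMoment_transpose, h, Matrix.transpose_zero]

end Moments

/-! ### First and second moments of the Gaussian law. -/

section Gaussian

variable {n : ℕ} (S : Matrix (Fin n) (Fin n) ℝ)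

theorem memLp_eval_multivariateGaussian (i : Fin n) :
    MemLp (fun x : EuclideanSpace ℝ (Fin n) => x i) 2 (multivariateGaussian 0 S) :=
  IsGaussian.memLp_dual _ (EuclideanSpace.proj i : EuclideanSpace ℝ (Fin n) →L[ℝ] ℝ) 2 (by simp)

theorem integral_eval_multivariateGaussian (i : Fin n) :
    ∫ x : EuclideanSpace ℝ (Fin n), x i ∂(multivariateGaussian 0 S) = 0 := by
  have := (EuclideanSpace.proj i : EuclideanSpace ℝ (Fin n) →L[ℝ] ℝ).integral_comp_id_comm
    (IsGaussian.integrable_id (μ := multivariateGaussian 0 S))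
  simpa using this

variable {S}

theorem integral_mul_eval_multivariateGaussian (hS : S.PosSemidef) (i j : Fin n) :
    ∫ x : EuclideanSpace ℝ (Fin n), x i * x j ∂(multivariateGaussian 0 S) = S i j := by
  have h := covariance_eval_multivariateGaussian (μ := 0) hS i j
  rw [covariance_eq_sub (memLp_eval_multivariateGaussian S i)
    (memLp_eval_multivariateGaussian S j), integral_eval_multivariateGaussian] at h
  simpa using h

end Gaussian

/-! ### Correlations of the noises and the recursion for the error covariance. -/

namespace LinearGaussianSystem

variable {n m : ℕ} (s : LinearGaussianSystem n m)

/-- The process noise `w(t)`. -/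
def processNoise (t : ℕ) (ω : Sample n m) : Fin n → ℝ := WithLp.ofLp (ω.2.1 t)

/-- The measurement noise `v(t)`. -/
def measurementNoise (t : ℕ) (ω : Sample n m) : Fin m → ℝ := WithLp.ofLp (ω.2.2 t)

/-- The initial state `x(0)`. -/
def initialState (ω : Sample n m) : Fin n → ℝ := WithLp.ofLp ω.1

instance : IsProbabilityMeasure s.noiseLaw := by
  unfold noiseLaw
  infer_instance

theorem measurePreserving_initialState :
    MeasurePreserving (fun ω : Sample n m => ω.1) s.noiseLaw
      (multivariateGaussian 0 s.Sigma0) :=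
  measurePreserving_fst

theorem measurePreserving_processNoise (t : ℕ) :
    MeasurePreserving (fun ω : Sample n m => ω.2.1 t) s.noiseLaw (multivariateGaussian 0 s.Q) :=
  (measurePreserving_eval_infinitePi (fun _ : ℕ => multivariateGaussian 0 s.Q) t).comp
    (measurePreserving_fst.comp measurePreserving_snd)

theorem measurePreserving_measurementNoise (t : ℕ) :
    MeasurePreserving (fun ω : Sample n m => ω.2.2 t) s.noiseLaw (multivariateGaussian 0 s.R) :=
  (measurePreserving_eval_infinitePi (fun _ : ℕ => multivariateGaussian 0 s.R) t).comp
    (measurePreserving_snd.comp measurePreserving_snd)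

theorem sqIntegrable_initialState : SqIntegrable s.noiseLaw (initialState (n := n) (m := m)) :=
  fun i => (memLp_eval_multivariateGaussian _ i).comp_measurePreserving
    s.measurePreserving_initialState

theorem sqIntegrable_processNoise (t : ℕ) :
    SqIntegrable s.noiseLaw (processNoise (n := n) (m := m) t) :=
  fun i => (memLp_eval_multivariateGaussian _ i).comp_measurePreserving
    (s.measurePreserving_processNoise t)

theorem sqIntegrable_measurementNoise (t : ℕ) :
    SqIntegrable s.noiseLaw (measurementNoise (n := n) (m := m) t) :=
  fun i => (memLp_eval_multivariateGaussian _ i).comp_measurePreserving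
    (s.measurePreserving_measurementNoise t)

theorem integral_infinitePi_eval {p : ℕ} (S : Matrix (Fin p) (Fin p) ℝ) (t : ℕ) (i : Fin p) :
    ∫ x, x t i ∂(Measure.infinitePi fun _ : ℕ => multivariateGaussian 0 S) = 0 := by
  have h := measurePreserving_eval_infinitePi (fun _ : ℕ => multivariateGaussian 0 S) t
  have h1 := integral_eval_multivariateGaussian S i
  rwa [← h.map_eq, integral_map h.measurable.aemeasurable (by fun_prop)] at h1

theorem integral_infinitePi_eval_mul {p : ℕ} {S : Matrix (Fin p) (Fin p) ℝ} (hS : S.PosSemidef)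
    (t k : ℕ) (i j : Fin p) :
    ∫ x, x t i * x k j ∂(Measure.infinitePi fun _ : ℕ => multivariateGaussian 0 S) =
      if t = k then S i j else 0 := by
  split_ifs with htk
  · subst htk
    have h := measurePreserving_eval_infinitePi (fun _ : ℕ => multivariateGaussian 0 S) t
    have h1 := integral_mul_eval_multivariateGaussian hS i j
    rwa [← h.map_eq, integral_map h.measurable.aemeasurable (by fun_prop)] at h1
  · have h := Measure.infinitePi_map_eval_prod (P := fun _ : ℕ => multivariateGaussian 0 S) htk
    have h2 := integral_prod_mul (μ := multivariateGaussian 0 S) (ν := multivariateGaussian 0 S)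
      (fun x : EuclideanSpace ℝ (Fin p) => x i) (fun x => x j)
    rw [← h, integral_map (by fun_prop) (by fun_prop), integral_eval_multivariateGaussian,
      zero_mul] at h2
    exact h2

theorem crossMoment_initialState_processNoise (t : ℕ) :
    crossMoment s.noiseLaw (initialState (n := n) (m := m)) (processNoise t) = 0 := by
  ext i j
  have := integral_prod_mul (μ := multivariateGaussian 0 s.Sigma0)
    (ν := (Measure.infinitePi fun _ : ℕ => multivariateGaussian 0 s.Q).prod
      (Measure.infinitePi fun _ : ℕ => multivariateGaussian 0 s.R))
    (fun x : EuclideanSpace ℝ (Fin n) => x i) (fun y => y.1 t j)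
  rw [integral_eval_multivariateGaussian, zero_mul] at this
  exact this

theorem crossMoment_initialState_measurementNoise (t : ℕ) :
    crossMoment s.noiseLaw (initialState (n := n) (m := m)) (measurementNoise t) = 0 := by
  ext i j
  have := integral_prod_mul (μ := multivariateGaussian 0 s.Sigma0)
    (ν := (Measure.infinitePi fun _ : ℕ => multivariateGaussian 0 s.Q).prod
      (Measure.infinitePi fun _ : ℕ => multivariateGaussian 0 s.R))
    (fun x : EuclideanSpace ℝ (Fin n) => x i) (fun y => y.2 t j)
  rw [integral_eval_multivariateGaussian, zero_mul] at this
  exact this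

theorem crossMoment_processNoise_measurementNoise (t k : ℕ) :
    crossMoment s.noiseLaw (processNoise (n := n) (m := m) t) (measurementNoise k) = 0 := by
  ext i j
  have h1 := integral_fun_snd (μ := multivariateGaussian 0 s.Sigma0)
    (ν := (Measure.infinitePi fun _ : ℕ => multivariateGaussian 0 s.Q).prod
      (Measure.infinitePi fun _ : ℕ => multivariateGaussian 0 s.R))
    (fun y => y.1 t i * y.2 k j)
  have h2 := integral_prod_mul (μ := Measure.infinitePi fun _ : ℕ => multivariateGaussian 0 s.Q)
    (ν := Measure.infinitePi fun _ : ℕ => multivariateGaussian 0 s.R)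
    (fun y => y t i) (fun y => y k j)
  rw [h2, integral_infinitePi_eval, zero_mul, smul_zero] at h1
  exact h1

theorem crossMoment_processNoise (hQ : s.Q.PosSemidef) (t k : ℕ) :
    crossMoment s.noiseLaw (processNoise (n := n) (m := m) t) (processNoise k) =
      if t = k then s.Q else 0 := by
  ext i j
  have h1 := (measurePreserving_fst (μ := Measure.infinitePi fun _ : ℕ =>
    multivariateGaussian 0 s.Q) (ν := Measure.infinitePi fun _ : ℕ =>
      multivariateGaussian 0 s.R)).comp
    (measurePreserving_snd (μ := multivariateGaussian 0 s.Sigma0))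
  have h2 := integral_infinitePi_eval_mul hQ t k i j
  rw [← h1.map_eq, integral_map h1.measurable.aemeasurable (by fun_prop)] at h2
  have h3 : crossMoment s.noiseLaw (processNoise (n := n) (m := m) t) (processNoise k) i j =
    if t = k then s.Q i j else 0 := h2
  rw [h3]
  split_ifs <;> rfl

theorem crossMoment_measurementNoise (hR : s.R.PosSemidef) (t k : ℕ) :
    crossMoment s.noiseLaw (measurementNoise (n := n) (m := m) t) (measurementNoise k) =
      if t = k then s.R else 0 := by
  ext i j
  have h1 := (measurePreserving_snd (μ := Measure.infinitePi fun _ : ℕ =>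
    multivariateGaussian 0 s.Q) (ν := Measure.infinitePi fun _ : ℕ =>
      multivariateGaussian 0 s.R)).comp
    (measurePreserving_snd (μ := multivariateGaussian 0 s.Sigma0))
  have h2 := integral_infinitePi_eval_mul hR t k i j
  rw [← h1.map_eq, integral_map h1.measurable.aemeasurable (by fun_prop)] at h2
  have h3 : crossMoment s.noiseLaw (measurementNoise (n := n) (m := m) t) (measurementNoise k) i j =
    if t = k then s.R i j else 0 := h2
  rw [h3]
  split_ifs <;> rfl

theorem crossMoment_const_processNoise {p : ℕ} (c : Fin p → ℝ) (t : ℕ) :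
    crossMoment s.noiseLaw (fun _ => c) (processNoise (n := n) (m := m) t) = 0 := by
  ext i j
  have h := s.measurePreserving_processNoise t
  have h1 := integral_eval_multivariateGaussian s.Q j
  rw [← h.map_eq, integral_map h.measurable.aemeasurable (by fun_prop)] at h1
  simp only [crossMoment, Matrix.of_apply, integral_const_mul, processNoise, h1, mul_zero,
    Matrix.zero_apply]

theorem crossMoment_const_measurementNoise {p : ℕ} (c : Fin p → ℝ) (t : ℕ) :
    crossMoment s.noiseLaw (fun _ => c) (measurementNoise (n := n) (m := m) t) = 0 := by
  ext i j
  have h := s.measurePreserving_measurementNoise t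
  have h1 := integral_eval_multivariateGaussian s.R j
  rw [← h.map_eq, integral_map h.measurable.aemeasurable (by fun_prop)] at h1
  simp only [crossMoment, Matrix.of_apply, integral_const_mul, measurementNoise, h1, mul_zero,
    Matrix.zero_apply]

theorem error_succ (K : Matrix (Fin n) (Fin m) ℝ) (ω : Sample n m) (t : ℕ) :
    s.error K ω (t + 1) = ((s.A - K * s.C * s.A) *ᵥ s.error K ω t
      + (1 - K * s.C) *ᵥ processNoise t ω) + (-K) *ᵥ measurementNoise (t + 1) ω := by
  simp only [error, estimate, output, state, processNoise, measurementNoise, Matrix.mulVec_add,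
    Matrix.mulVec_sub, Matrix.sub_mulVec, Matrix.neg_mulVec, Matrix.mulVec_mulVec,
    Matrix.one_mulVec, Matrix.mul_assoc]
  abel

/-- The error at time `t` involves `w` only before `t` but `v` up to and including `t`, hence `t ≤
k` for `w` and `t < k` for `v`. Only uncorrelatedness is propagated, which suffices for second
moments. -/
theorem error_orthogonal (hQ : s.Q.PosSemidef) (hR : s.R.PosSemidef)
    (K : Matrix (Fin n) (Fin m) ℝ) (t : ℕ) :
    SqIntegrable s.noiseLaw (fun ω => s.error K ω t) ∧
    (∀ k, t ≤ k → crossMoment s.noiseLaw (fun ω => s.error K ω t) (processNoise k) = 0) ∧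
    (∀ k, t < k → crossMoment s.noiseLaw (fun ω => s.error K ω t) (measurementNoise k) = 0) := by
  induction t with
  | zero =>
    have h0 : (fun ω => s.error K ω 0) = fun ω => initialState ω + -s.xhat0 := by
      funext ω
      simp [error, state, estimate, initialState, sub_eq_add_neg]
    have hc : SqIntegrable s.noiseLaw (fun _ : Sample n m => -s.xhat0) := fun i => memLp_const _
    have hx := s.sqIntegrable_initialState
    rw [h0]
    refine ⟨hx.add hc, fun k _ => ?_, fun k _ => ?_⟩
    · rw [crossMoment_add_left hx hc (s.sqIntegrable_processNoise k),
        crossMoment_initialState_processNoise, crossMoment_const_processNoise, add_zero]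
    · rw [crossMoment_add_left hx hc (s.sqIntegrable_measurementNoise k),
        crossMoment_initialState_measurementNoise, crossMoment_const_measurementNoise, add_zero]
  | succ t ih =>
    obtain ⟨he, hew, hev⟩ := ih
    have hw := s.sqIntegrable_processNoise
    have hv := s.sqIntegrable_measurementNoise
    have h1 := (he.mulVec (s.A - K * s.C * s.A)).add ((hw t).mulVec (1 - K * s.C))
    have h2 := (hv (t + 1)).mulVec (-K)
    simp only [error_succ]
    refine ⟨h1.add h2, fun k hk => ?_, fun k hk => ?_⟩
    · rw [crossMoment_add_left h1 h2 (hw k), crossMoment_add_left (he.mulVec _)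
        ((hw t).mulVec _) (hw k), crossMoment_mulVec_left he (hw k),
        crossMoment_mulVec_left (hw t) (hw k), crossMoment_mulVec_left (hv _) (hw k),
        hew k (by omega), s.crossMoment_processNoise hQ, if_neg (by omega),
        crossMoment_eq_zero_comm (s.crossMoment_processNoise_measurementNoise k (t + 1))]
      simp
    · rw [crossMoment_add_left h1 h2 (hv k), crossMoment_add_left (he.mulVec _)
        ((hw t).mulVec _) (hv k), crossMoment_mulVec_left he (hv k),
        crossMoment_mulVec_left (hw t) (hv k), crossMoment_mulVec_left (hv _) (hv k),
        hev k (by omega), s.crossMoment_measurementNoise hR, if_neg (by omega),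
        s.crossMoment_processNoise_measurementNoise t k]
      simp

/-- The recursion for the error covariance. -/
theorem errorCov_succ (hQ : s.Q.PosSemidef) (hR : s.R.PosSemidef)
    (K : Matrix (Fin n) (Fin m) ℝ) (t : ℕ) :
    s.errorCov K (t + 1) = (s.A - K * s.C * s.A) * s.errorCov K t * (s.A - K * s.C * s.A)ᵀ
      + filterNoise s.C s.Q s.R K := by
  have hcov : ∀ t, s.errorCov K t =
    crossMoment s.noiseLaw (fun ω => s.error K ω t) (fun ω => s.error K ω t) := fun _ => rfl
  obtain ⟨he, hew, hev⟩ := s.error_orthogonal hQ hR K t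
  have hw := s.sqIntegrable_processNoise t
  have hv := s.sqIntegrable_measurementNoise (t + 1)
  have hew := hew t le_rfl
  have hev := hev (t + 1) (Nat.lt_succ_self t)
  have hwe := crossMoment_eq_zero_comm hew
  have hve := crossMoment_eq_zero_comm hev
  have hwv := s.crossMoment_processNoise_measurementNoise t (t + 1)
  have hvw := crossMoment_eq_zero_comm hwv
  have hww := s.crossMoment_processNoise hQ t t
  have hvv := s.crossMoment_measurementNoise hR (t + 1) (t + 1)
  rw [if_pos rfl] at hww hvv
  rw [hcov, hcov]
  simp only [error_succ]
  have he' := he.mulVec (s.A - K * s.C * s.A)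
  have hw' := hw.mulVec (1 - K * s.C)
  have hv' := hv.mulVec (-K)
  -- The product expands into nine cross moments, of which the six mixed ones vanish.
  rw [crossMoment_add_left (he'.add hw') hv' ((he'.add hw').add hv'),
    crossMoment_add_left he' hw' ((he'.add hw').add hv'),
    crossMoment_add_right he' (he'.add hw') hv', crossMoment_add_right hw' (he'.add hw') hv',
    crossMoment_add_right hv' (he'.add hw') hv', crossMoment_add_right he' he' hw',
    crossMoment_add_right hw' he' hw', crossMoment_add_right hv' he' hw']
  rw [crossMoment_mulVec_left he he', crossMoment_mulVec_left he hw',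
    crossMoment_mulVec_left he hv', crossMoment_mulVec_left hw he',
    crossMoment_mulVec_left hw hw', crossMoment_mulVec_left hw hv',
    crossMoment_mulVec_left hv he', crossMoment_mulVec_left hv hw',
    crossMoment_mulVec_left hv hv', crossMoment_mulVec_right he he,
    crossMoment_mulVec_right he hw, crossMoment_mulVec_right he hv,
    crossMoment_mulVec_right hw he, crossMoment_mulVec_right hw hw,
    crossMoment_mulVec_right hw hv, crossMoment_mulVec_right hv he,
    crossMoment_mulVec_right hv hw, crossMoment_mulVec_right hv hv,
    hew, hev, hwe, hve, hwv, hvw, hww, hvv]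
  simp [filterNoise, Matrix.mul_assoc, add_assoc]

end LinearGaussianSystem

/-! ### Perturbation and scaling of the noise covariances. -/

section Auxiliary

variable {n m : ℕ} {A : Matrix (Fin n) (Fin n) ℝ} {C : Matrix (Fin m) (Fin n) ℝ}
  {V X : Matrix (Fin n) (Fin n) ℝ} {W : Matrix (Fin m) (Fin m) ℝ}

/-- Positive definiteness is stable under small symmetric perturbations. -/
theorem Matrix.PosDef.eventually_posSemidef_add_smul (hW : W.PosDef)
    {D : Matrix (Fin m) (Fin m) ℝ} (hD : D.IsSymm) :
    ∀ᶠ ε : ℝ in 𝓝 0, (W + ε • D).PosSemidef := by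
  have hc : Continuous fun p : ℝ × (Fin m → ℝ) => p.2 ⬝ᵥ (W + p.1 • D) *ᵥ p.2 := by fun_prop
  have h1 : ∀ᶠ ε : ℝ in 𝓝 0, ∀ x ∈ Metric.sphere (0 : Fin m → ℝ) 1,
      0 < x ⬝ᵥ (W + ε • D) *ᵥ x := by
    -- Compactness of the unit sphere makes one range of `ε` work for all directions; homogeneity
    -- then covers all vectors.
    refine (isCompact_sphere (0 : Fin m → ℝ) 1).eventually_forall_of_forall_eventually
      fun x hx => ?_
    refine hc.continuousAt.eventually (lt_mem_nhds ?_)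
    have hx0 : x ≠ 0 := by
      rintro rfl
      simp at hx
    simpa using hW.dotProduct_mulVec_pos hx0
  filter_upwards [h1] with ε hε
  refine Matrix.PosSemidef.of_dotProduct_mulVec_nonneg ?_ fun x => ?_
  · rw [Matrix.IsHermitian, Matrix.conjTranspose_eq_transpose_of_trivial, Matrix.transpose_add,
      Matrix.transpose_smul, hD.eq, hW.posSemidef.transpose_eq_real]
  · rw [star_trivial]
    rcases eq_or_ne x 0 with rfl | hx
    · simp
    · have hx' : ‖x‖ ≠ 0 := norm_ne_zero_iff.2 hx
      have h2 := hε (‖x‖⁻¹ • x) (by simp [norm_smul, hx'])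
      rw [Matrix.mulVec_smul, dotProduct_smul, smul_dotProduct, smul_eq_mul, smul_eq_mul,
        ← mul_assoc] at h2
      exact (pos_of_mul_pos_right h2 (mul_self_nonneg _)).le

theorem filterNoise_add_smul (K : Matrix (Fin n) (Fin m) ℝ) (ε : ℝ)
    (D : Matrix (Fin m) (Fin m) ℝ) :
    filterNoise C V (W + ε • D) K = filterNoise C V W K + ε • (K * D * Kᵀ) := by
  simp [filterNoise, Matrix.mul_add, Matrix.add_mul, add_assoc]

theorem filterNoise_smul_one_add_smul (K : Matrix (Fin n) (Fin m) ℝ) (c : ℝ) :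
    filterNoise C (c • V) (1 + c • W) K = K * Kᵀ + c • filterNoise C V W K := by
  simp only [filterNoise, Matrix.mul_add, Matrix.add_mul, Matrix.mul_smul, Matrix.smul_mul,
    Matrix.mul_one, smul_add]
  abel

theorem gainOf_smul {c : ℝ} (hc : c ≠ 0) (hX : X.PosSemidef) (hW : W.PosDef) :
    gainOf C (c • W) (c • X) = gainOf C W X := by
  have h1 : C * (c • X) * Cᵀ + c • W = c • (C * X * Cᵀ + W) := by simp
  have h2 : (c • (C * X * Cᵀ + W))⁻¹ = c⁻¹ • (C * X * Cᵀ + W)⁻¹ := by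
    have hu := (Matrix.isUnit_iff_isUnit_det _).1 (innovationCov_posDef (C := C) hX hW).isUnit
    refine Matrix.inv_eq_left_inv ?_
    rw [Matrix.smul_mul, Matrix.mul_smul, smul_smul, inv_mul_cancel₀ hc, one_smul,
      Matrix.nonsing_inv_mul _ hu]
  rw [gainOf, h1, h2, gainOf]
  simp [smul_smul, hc]

/-- The equation is homogeneous in `(V, W, X)` jointly while the gain is invariant; this makes the
limit `λ → ∞` accessible. -/
theorem IsRiccatiSolution.smul {c : ℝ} (hc : 0 < c) (hW : W.PosDef)
    (hX : IsRiccatiSolution A C V W X) : IsRiccatiSolution A C (c • V) (c • W) (c • X) := by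
  have hX' : (c • X).PosSemidef := hX.1.smul hc.le
  refine ⟨hX', ?_⟩
  rw [riccatiMap_eq _ hX' (hW.smul hc), filterNoise_gainOf hX' (hW.smul hc),
    gainOf_smul hc.ne' hX.1 hW]
  nth_rw 1 [hX.eq_step hW, filterNoise_gainOf hX.1 hW]
  simp [Matrix.mul_sub, Matrix.sub_mul, smul_sub]

theorem one_add_smul_posDef (hW : W.PosDef) {c : ℝ} (hc : 0 ≤ c) : (1 + c • W).PosDef :=
  Matrix.PosDef.one.add_posSemidef (hW.posSemidef.smul hc)

end Auxiliary

/-! ### Formulas for `𝒫` and `𝒮`, and the optimal gains. -/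

namespace LinearGaussianSystem

variable {n m : ℕ} {s : LinearGaussianSystem n m} {K : Matrix (Fin n) (Fin m) ℝ}

theorem Admissible.schurStable (hK : s.Admissible K) : SchurStable (s.A - K * s.C * s.A) := hK

theorem Admissible.tendsto_errorCov (hK : s.Admissible K) (hQ : s.Q.PosSemidef)
    (hR : s.R.PosSemidef) : Tendsto (s.errorCov K) atTop
      (𝓝 (hK.schurStable.lyapunov (filterNoise s.C s.Q s.R K))) :=
  hK.schurStable.tendsto_of_recursion (s.errorCov_succ hQ hR K) (hK.schurStable.lyapunov_eq _)

theorem Admissible.steadyCov_eq (hK : s.Admissible K) (hQ : s.Q.PosSemidef)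
    (hR : s.R.PosSemidef) :
    s.steadyCov K = hK.schurStable.lyapunov (filterNoise s.C s.Q s.R K) :=
  (hK.tendsto_errorCov hQ hR).limUnder_eq

theorem Admissible.perf_eq (hK : s.Admissible K) (hQ : s.Q.PosSemidef) (hR : s.R.PosSemidef) :
    s.perf K = (hK.schurStable.lyapunov (filterNoise s.C s.Q s.R K)).trace := by
  rw [perf, hK.steadyCov_eq hQ hR]

/-- The derivative of the steady-state error with respect to `R`, as a linear functional. -/
noncomputable def Admissible.perfDeriv (hK : s.Admissible K) :
    Matrix (Fin m) (Fin m) ℝ →ₗ[ℝ] ℝ where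
  toFun D := (hK.schurStable.lyapunov (K * D * Kᵀ)).trace
  map_add' D D' := by simp [Matrix.mul_add, Matrix.add_mul]
  map_smul' c D := by simp

theorem Admissible.hasDerivAt_perf (hK : s.Admissible K) (hQ : s.Q.PosSemidef) (hR : s.R.PosDef)
    {D : Matrix (Fin m) (Fin m) ℝ} (hD : D.IsSymm) :
    HasDerivAt (fun ε : ℝ => (s.withR (s.R + ε • D)).perf K) (hK.perfDeriv D) 0 := by
  have h1 : (fun ε : ℝ => (s.withR (s.R + ε • D)).perf K) =ᶠ[𝓝 0]
      fun ε => s.perf K + ε * hK.perfDeriv D := by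
    -- The Lyapunov formula is available when the perturbed matrix is still a covariance, which
    -- holds for `ε` near `0`; there `𝒫` is exactly affine in `ε`.
    filter_upwards [hR.eventually_posSemidef_add_smul hD] with ε hε
    have hK' : (s.withR (s.R + ε • D)).Admissible K := hK
    have h2 := hK'.perf_eq (s := s.withR (s.R + ε • D)) hQ hε
    rw [h2, hK.perf_eq hQ hR.posSemidef]
    change (hK.schurStable.lyapunov (filterNoise s.C s.Q (s.R + ε • D) K)).trace = _
    rw [filterNoise_add_smul, map_add, map_smul, Matrix.trace_add, Matrix.trace_smul, smul_eq_mul]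
    rfl
  refine HasDerivAt.congr_of_eventuallyEq ?_ h1
  simpa using ((hasDerivAt_id (0 : ℝ)).mul_const (hK.perfDeriv D)).const_add (s.perf K)

theorem Admissible.perfGradR_apply (hK : s.Admissible K) (hQ : s.Q.PosSemidef) (hR : s.R.PosDef)
    (i j : Fin m) : s.perfGradR K i j = hK.perfDeriv
      ((1 / 2 : ℝ) • (Matrix.single i j (1 : ℝ) + Matrix.single j i (1 : ℝ))) := by
  refine (hK.hasDerivAt_perf hQ hR ?_).deriv
  rw [Matrix.IsSymm, Matrix.transpose_smul, Matrix.transpose_add, Matrix.transpose_single,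
    Matrix.transpose_single, add_comm]

theorem Admissible.trace_perfGradR_mul (hK : s.Admissible K) (hQ : s.Q.PosSemidef)
    (hR : s.R.PosDef) {D : Matrix (Fin m) (Fin m) ℝ} (hD : D.IsSymm) :
    ((s.perfGradR K)ᵀ * D).trace = hK.perfDeriv D := by
  -- A symmetric matrix expands in the symmetrized matrix units with its own entries as
  -- coefficients.
  have h1 : D = ∑ j, ∑ i, D i j •
      ((1 / 2 : ℝ) • (Matrix.single i j (1 : ℝ) + Matrix.single j i (1 : ℝ))) := by
    ext a b
    have hab : D b a = D a b := hD.apply a b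
    simp [Matrix.sum_apply, Matrix.single_apply, Finset.sum_add_distrib, ite_and, hab]
    ring
  nth_rw 2 [h1]
  simp only [map_sum, map_smul, smul_eq_mul, ← hK.perfGradR_apply hQ hR]
  simp [Matrix.trace, Matrix.mul_apply, mul_comm]

/-- The trace of the gradient is the derivative in the direction of the identity matrix. -/
theorem Admissible.sens_eq (hK : s.Admissible K) (hQ : s.Q.PosSemidef) (hR : s.R.PosDef) :
    s.sens K = (hK.schurStable.lyapunov (K * Kᵀ)).trace := by
  have h := hK.trace_perfGradR_mul hQ hR (D := 1) Matrix.isSymm_one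
  rw [Matrix.mul_one, Matrix.trace_transpose] at h
  rw [sens, h]
  change (hK.schurStable.lyapunov (K * 1 * Kᵀ)).trace = _
  rw [Matrix.mul_one]

theorem Admissible.sens_add_smul_perf (hK : s.Admissible K) (hQ : s.Q.PosSemidef)
    (hR : s.R.PosDef) (c : ℝ) : s.sens K + c * s.perf K =
      (hK.schurStable.lyapunov (filterNoise s.C (c • s.Q) (1 + c • s.R) K)).trace := by
  rw [hK.sens_eq hQ hR, hK.perf_eq hQ hR.posSemidef, filterNoise_smul_one_add_smul, map_add,
    map_smul, Matrix.trace_add, Matrix.trace_smul, smul_eq_mul]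

theorem Admissible.sens_nonneg (hK : s.Admissible K) (hQ : s.Q.PosSemidef) (hR : s.R.PosDef) :
    0 ≤ s.sens K := by
  rw [hK.sens_eq hQ hR]
  refine (hK.schurStable.lyapunov_posSemidef ?_).trace_nonneg
  simpa using (Matrix.PosSemidef.one (n := Fin m) (R := ℝ)).mul_mul_transpose_real K

theorem admissible_zero (hA : SchurStable s.A) : s.Admissible 0 := by
  simpa [Admissible] using hA

theorem sens_zero (hA : SchurStable s.A) (hQ : s.Q.PosSemidef) (hR : s.R.PosDef) :
    s.sens 0 = 0 := by
  rw [(admissible_zero hA).sens_eq hQ hR]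
  simp

/-- The gain of a Riccati solution is the unique minimizer of the corresponding cost. -/
theorem isUniqueMinimizer_gainOf (hA : SchurStable s.A) {V : Matrix (Fin n) (Fin n) ℝ}
    {W : Matrix (Fin m) (Fin m) ℝ} (hV : V.PosSemidef) (hW : W.PosDef)
    {f : Matrix (Fin n) (Fin m) ℝ → ℝ}
    (hf : ∀ K (hK : s.Admissible K),
      f K = (hK.schurStable.lyapunov (filterNoise s.C V W K)).trace) :
    IsUniqueMinimizer f {K | s.Admissible K} (gainOf s.C W (riccatiSolution s.A s.C V W)) := by
  have hX := riccatiSolution_spec (C := s.C) hA hV hW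
  have hG : s.Admissible (gainOf s.C W (riccatiSolution s.A s.C V W)) := hX.schurStable hA hV hW
  refine ⟨hG, fun K hK hne => ?_⟩
  rw [hf _ hG, hf K hK, hX.lyapunov_gainOf hW hG]
  exact hX.trace_lt hW hK hne

theorem isUniqueMinimizer_kalmanGain (hA : SchurStable s.A) (hQ : s.Q.PosSemidef)
    (hR : s.R.PosDef) : IsUniqueMinimizer s.perf {K | s.Admissible K} s.kalmanGain :=
  isUniqueMinimizer_gainOf hA hQ hR fun _ hK => hK.perf_eq hQ hR.posSemidef

theorem isUniqueMinimizer_optGain (hA : SchurStable s.A) (hQ : s.Q.PosSemidef)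
    (hR : s.R.PosDef) {lam : ℝ} (hlam : 0 ≤ lam) :
    IsUniqueMinimizer (fun K => s.sens K + lam * s.perf K) {K | s.Admissible K}
      (s.optGain lam) :=
  isUniqueMinimizer_gainOf hA (hQ.smul hlam) (one_add_smul_posDef hR hlam)
    fun _ hK => hK.sens_add_smul_perf hQ hR lam

theorem existsUnique_isRiccatiSolution (hA : SchurStable s.A) {V : Matrix (Fin n) (Fin n) ℝ}
    {W : Matrix (Fin m) (Fin m) ℝ} (hV : V.PosSemidef) (hW : W.PosDef) :
    ∃! X, IsRiccatiSolution s.A s.C V W X :=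
  ⟨_, riccatiSolution_spec hA hV hW,
    fun _ hY => hY.unique hA hV hW (riccatiSolution_spec hA hV hW)⟩

theorem optGain_zero (hA : SchurStable s.A) : s.optGain 0 = 0 := by
  have h0 : IsRiccatiSolution s.A s.C 0 1 0 := ⟨Matrix.PosSemidef.zero, by simp [riccatiMap]⟩
  have h := (riccatiSolution_spec hA Matrix.PosSemidef.zero Matrix.PosDef.one).unique hA
    Matrix.PosSemidef.zero Matrix.PosDef.one h0
  simp [optGain, h, gainOf]

/-- Lagrangian sufficiency: a feasible `K` has `lam * 𝒫(K) ≤ lam * δ`, with equality at `K*(lam)`,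
so the strict minimum of `𝒮 + lam 𝒫` passes to `𝒮`. -/
theorem isUniqueMinimizer_sens_optGain (hA : SchurStable s.A) (hQ : s.Q.PosSemidef)
    (hR : s.R.PosDef) {lam δ : ℝ} (hlam : 0 ≤ lam) (h : s.perf (s.optGain lam) = δ) :
    IsUniqueMinimizer s.sens (s.feasible δ) (s.optGain lam) := by
  obtain ⟨h1, h2⟩ := isUniqueMinimizer_optGain hA hQ hR hlam
  refine ⟨⟨h1, h.le⟩, fun K hK hne => ?_⟩
  have h3 := h2 K hK.1 hne
  have h4 := mul_le_mul_of_nonneg_left (hK.2.trans h.ge) hlam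
  simp only at h3
  linarith

theorem isUniqueMinimizer_sens_kalmanGain (hA : SchurStable s.A) (hQ : s.Q.PosSemidef)
    (hR : s.R.PosDef) :
    IsUniqueMinimizer s.sens (s.feasible (s.perf s.kalmanGain)) s.kalmanGain := by
  obtain ⟨h1, h2⟩ := isUniqueMinimizer_kalmanGain hA hQ hR
  exact ⟨⟨h1, le_rfl⟩, fun K hK hne => absurd hK.2 (not_le.2 (h2 K hK.1 hne))⟩

/-- Comparison with the gain `0`, whose sensitivity is `0 ≤ 𝒮`. It provides the uniform bound for
the compactness argument in `tendsto_perf`. -/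
theorem perf_optGain_le (hA : SchurStable s.A) (hQ : s.Q.PosSemidef) (hR : s.R.PosDef)
    {lam : ℝ} (hlam : 0 ≤ lam) : s.perf (s.optGain lam) ≤ s.perf 0 := by
  rcases eq_or_ne 0 (s.optGain lam) with h | h
  · rw [← h]
  · obtain ⟨h1, h2⟩ := isUniqueMinimizer_optGain hA hQ hR hlam
    have h3 := h2 0 (admissible_zero hA) h
    have h4 := Admissible.sens_nonneg h1 hQ hR
    simp only [sens_zero hA hQ hR] at h3
    by_contra hlt
    have := mul_le_mul_of_nonneg_left (not_le.1 hlt).le hlam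
    linarith

/-- If a gain is optimal for two different multipliers, it is the Kalman gain. -/
theorem optGain_eq_kalmanGain (hA : SchurStable s.A) (hQ : s.Q.PosSemidef) (hR : s.R.PosDef)
    {lam lam' : ℝ} (hlam : 0 ≤ lam) (hlam' : 0 ≤ lam') (hne : lam ≠ lam')
    (h : s.optGain lam = s.optGain lam') : s.optGain lam = s.kalmanGain := by
  set K := s.optGain lam
  have hadm : s.Admissible K := (isUniqueMinimizer_optGain hA hQ hR hlam).1
  set Pk := hadm.schurStable.lyapunov (filterNoise s.C s.Q s.R K) with hPk
  set Sk := hadm.schurStable.lyapunov (K * Kᵀ) with hSk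
  set M := s.A * Pk * s.Aᵀ + s.Q with hM
  have hMpos : M.PosSemidef := ((hadm.schurStable.lyapunov_posSemidef
    (filterNoise_posSemidef hQ hR.posSemidef K)).mul_mul_transpose_real s.A).add hQ
  -- With `K` fixed, the Riccati solution for `l` is `A Sk Aᵀ + l M`, so the gain equation is affine
  -- in `l`. Vanishing at two values of `l` kills the coefficient of `l`, which is the Kalman gain
  -- equation for `M`.
  have key : ∀ l : ℝ, 0 ≤ l → s.optGain l = K →
      K * (s.C * (s.A * Sk * s.Aᵀ) * s.Cᵀ + 1) - s.A * Sk * s.Aᵀ * s.Cᵀ +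
        l • (K * (s.C * M * s.Cᵀ + s.R) - M * s.Cᵀ) = 0 := by
    intro l hl hlK
    have hX := riccatiSolution_spec (C := s.C) hA (hQ.smul hl) (one_add_smul_posDef hR hl)
    have hG := hX.schurStable hA (hQ.smul hl) (one_add_smul_posDef hR hl)
    have hgain := gainOf_mul (C := s.C) hX.1 (one_add_smul_posDef hR hl)
    have hP := hX.lyapunov_gainOf (one_add_smul_posDef hR hl) hG
    have hstep := hX.eq_step (one_add_smul_posDef hR hl)
    rw [← hP] at hstep
    change gainOf s.C (1 + l • s.R) (riccatiSolution s.A s.C (l • s.Q) (1 + l • s.R)) = K at hlK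
    simp only [hlK] at hstep hgain
    rw [filterNoise_smul_one_add_smul, map_add, map_smul, ← hPk, ← hSk] at hstep
    have hX2 : riccatiSolution s.A s.C (l • s.Q) (1 + l • s.R) = s.A * Sk * s.Aᵀ + l • M := by
      rw [hstep, hM]
      simp [Matrix.mul_add, Matrix.add_mul, add_assoc]
    rw [hX2] at hgain
    rw [← sub_eq_zero] at hgain
    rw [← hgain]
    simp only [Matrix.mul_add, Matrix.add_mul, Matrix.mul_smul, Matrix.smul_mul, smul_add,
      smul_sub]
    abel
  have h1 := key lam hlam rfl
  have h2 := key lam' hlam' h.symm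
  have h3 : (lam - lam') • (K * (s.C * M * s.Cᵀ + s.R) - M * s.Cᵀ) = 0 := by
    rw [sub_smul, eq_neg_of_add_eq_zero_right h1, eq_neg_of_add_eq_zero_right h2, sub_self]
  have h4 := (smul_eq_zero.1 h3).resolve_left (sub_ne_zero.2 hne)
  have h5 : K = gainOf s.C s.R M := eq_gainOf hMpos hR (sub_eq_zero.1 h4)
  have h6 : Pk = filterNoise s.C M s.R K := by
    rw [hM, filterNoise_step]
    exact hadm.schurStable.lyapunov_eq _
  have h7 : IsRiccatiSolution s.A s.C s.Q s.R M := by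
    refine ⟨hMpos, ?_⟩
    rw [riccatiMap_eq _ hMpos hR, ← h5, ← h6]
  rw [h5, kalmanGain, h7.unique hA hQ hR (riccatiSolution_spec hA hQ hR)]

/-- The bound `B` keeps the steady covariances in a compact set, and each limit point solves the
Lyapunov equation of the limit gain. -/
theorem tendsto_perf {ι : Type*} {l : Filter ι} {Ks : ι → Matrix (Fin n) (Fin m) ℝ} {B : ℝ}
    (hK : s.Admissible K) (hQ : s.Q.PosSemidef) (hR : s.R.PosDef) (hKs : Tendsto Ks l (𝓝 K))
    (hadm : ∀ᶠ t in l, s.Admissible (Ks t)) (hB : ∀ᶠ t in l, s.perf (Ks t) ≤ B) :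
    Tendsto (fun t => s.perf (Ks t)) l (𝓝 (s.perf K)) := by
  have hsol : ∀ K, s.Admissible K → (s.steadyCov K).PosSemidef ∧ s.steadyCov K =
      (s.A - K * s.C * s.A) * s.steadyCov K * (s.A - K * s.C * s.A)ᵀ
        + filterNoise s.C s.Q s.R K := by
    intro K hK
    rw [hK.steadyCov_eq hQ hR.posSemidef]
    exact ⟨hK.schurStable.lyapunov_posSemidef (filterNoise_posSemidef hQ hR.posSemidef K),
      hK.schurStable.lyapunov_eq _⟩
  have hlim : Tendsto (fun t => s.steadyCov (Ks t)) l (𝓝 (s.steadyCov K)) := by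
    refine tendsto_of_posSemidef_of_trace_le (hadm.mono fun t ht => (hsol _ ht).1) hB
      fun Z l' hl' hne _ hZ => ?_
    have hc : Continuous fun p : Matrix (Fin n) (Fin m) ℝ × Matrix (Fin n) (Fin n) ℝ =>
        (s.A - p.1 * s.C * s.A) * p.2 * (s.A - p.1 * s.C * s.A)ᵀ
          + filterNoise s.C s.Q s.R p.1 := by
      unfold filterNoise
      fun_prop
    have h1 := (hc.tendsto (K, Z)).comp ((hKs.mono_left hl').prodMk_nhds hZ)
    refine hK.schurStable.lyapunov_unique (tendsto_nhds_unique hZ (h1.congr' ?_)) (hsol K hK).2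
    filter_upwards [hl' hadm] with t ht using ((hsol _ ht).2).symm
  exact (continuous_id.matrix_trace.tendsto _).comp hlim

theorem tendsto_optGain (hA : SchurStable s.A) (hQ : s.Q.PosSemidef) (hR : s.R.PosDef)
    {lam : ℝ} (hlam : 0 ≤ lam) :
    Tendsto s.optGain (𝓝[Set.Ici 0] lam) (𝓝 (s.optGain lam)) := by
  have hid : Tendsto (fun l : ℝ => l) (𝓝[Set.Ici 0] lam) (𝓝 lam) := nhdsWithin_le_nhds
  have hW : Tendsto (fun l : ℝ => 1 + l • s.R) (𝓝[Set.Ici 0] lam) (𝓝 (1 + lam • s.R)) :=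
    (hid.smul_const s.R).const_add 1
  have hX := riccatiSolution_spec (C := s.C) hA (hQ.smul hlam) (one_add_smul_posDef hR hlam)
  refine tendsto_gainOf hX.1 (one_add_smul_posDef hR hlam)
    (tendsto_riccatiSolution hA (hQ.smul hlam) (one_add_smul_posDef hR hlam)
      (hid.smul_const s.Q) hW ?_ ?_) hW
  · filter_upwards [self_mem_nhdsWithin] with l hl using hQ.smul hl
  · filter_upwards [self_mem_nhdsWithin] with l hl using one_add_smul_posDef hR hl

/-- Dividing the weights by `l` shows that `K*(l)` is the Riccati gain for `Q` and `R + l⁻¹ I`, and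
the latter tends to `R`. -/
theorem tendsto_optGain_atTop (hA : SchurStable s.A) (hQ : s.Q.PosSemidef) (hR : s.R.PosDef) :
    Tendsto s.optGain atTop (𝓝 s.kalmanGain) := by
  have hW : Tendsto (fun l : ℝ => s.R + l⁻¹ • (1 : Matrix (Fin m) (Fin m) ℝ)) atTop (𝓝 s.R) := by
    simpa using ((tendsto_inv_atTop_zero (𝕜 := ℝ)).smul_const (1 : Matrix (Fin m) (Fin m) ℝ)).const_add s.R
  have hpos : ∀ l : ℝ, 0 < l → (s.R + l⁻¹ • (1 : Matrix (Fin m) (Fin m) ℝ)).PosDef :=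
    fun l hl => hR.add_posSemidef (Matrix.PosSemidef.one.smul (inv_nonneg.2 hl.le))
  have h1 := tendsto_gainOf (C := s.C) (riccatiSolution_spec (C := s.C) hA hQ hR).1 hR
    (tendsto_riccatiSolution hA hQ hR (tendsto_const_nhds (f := atTop)) hW
      (Eventually.of_forall fun _ => hQ) ((eventually_gt_atTop 0).mono hpos)) hW
  refine h1.congr' ?_
  filter_upwards [eventually_gt_atTop 0] with l hl
  have hX := riccatiSolution_spec (C := s.C) hA hQ (hpos l hl)
  have hW' : l • (s.R + l⁻¹ • (1 : Matrix (Fin m) (Fin m) ℝ)) = 1 + l • s.R := by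
    rw [smul_add, smul_smul, mul_inv_cancel₀ hl.ne', one_smul, add_comm]
  have hY := hX.smul hl (hpos l hl)
  rw [← gainOf_smul hl.ne' hX.1 (hpos l hl), optGain]
  rw [hW'] at hY ⊢
  rw [hY.unique hA (hQ.smul hl.le) (one_add_smul_posDef hR hl.le)
    (riccatiSolution_spec hA (hQ.smul hl.le) (one_add_smul_posDef hR hl.le))]

theorem existsUnique_perf_optGain_eq (hA : SchurStable s.A) (hQ : s.Q.PosSemidef)
    (hR : s.R.PosDef) {δ : ℝ} (hδ : δ ∈ Set.Ioc (s.perf s.kalmanGain) (s.perf 0)) :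
    ∃! lam : ℝ, 0 ≤ lam ∧ s.perf (s.optGain lam) = δ := by
  have hadm : ∀ l : ℝ, 0 ≤ l → s.Admissible (s.optGain l) :=
    fun l hl => (isUniqueMinimizer_optGain hA hQ hR hl).1
  have hcont : ContinuousOn (fun l => s.perf (s.optGain l)) (Set.Ici 0) := by
    intro l hl
    refine tendsto_perf (hadm l hl) hQ hR (tendsto_optGain hA hQ hR hl) (B := s.perf 0) ?_ ?_
    · filter_upwards [self_mem_nhdsWithin] with k hk using hadm k hk
    · filter_upwards [self_mem_nhdsWithin] with k hk using perf_optGain_le hA hQ hR hk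
  have hlim : Tendsto (fun l => s.perf (s.optGain l)) atTop (𝓝 (s.perf s.kalmanGain)) := by
    refine tendsto_perf (isUniqueMinimizer_kalmanGain hA hQ hR).1 hQ hR
      (tendsto_optGain_atTop hA hQ hR) (B := s.perf 0) ?_ ?_
    · filter_upwards [eventually_ge_atTop 0] with k hk using hadm k hk
    · filter_upwards [eventually_ge_atTop 0] with k hk using perf_optGain_le hA hQ hR hk
  -- As `δ` exceeds the limit of `𝒫(K*(l))`, some finite `L` already lies below `δ`; at `l = 0` the
  -- value is `𝒫(0) ≥ δ`.
  obtain ⟨L, hL, hL0⟩ := ((hlim.eventually (gt_mem_nhds hδ.1)).and (eventually_ge_atTop 0)).exists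
  obtain ⟨lam, hlam, hval⟩ := intermediate_value_Icc' hL0
    (hcont.mono Set.Icc_subset_Ici_self) ⟨hL.le, by simpa [optGain_zero hA] using hδ.2⟩
  refine ⟨lam, ⟨hlam.1, hval⟩, fun lam' ⟨h0, h1⟩ => ?_⟩
  by_contra hne
  have h2 := isUniqueMinimizer_sens_optGain hA hQ hR hlam.1 hval
  have h3 := isUniqueMinimizer_sens_optGain hA hQ hR h0 h1
  -- Both gains are the unique minimizer of the same constrained problem.
  have h4 : s.optGain lam' = s.optGain lam := by
    by_contra hne'
    exact lt_asymm (h2.2 _ h3.1 hne') (h3.2 _ h2.1 (Ne.symm hne'))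
  have h5 := optGain_eq_kalmanGain hA hQ hR h0 hlam.1 hne h4
  rw [h5] at h1
  exact hδ.1.ne h1

end LinearGaussianSystem

theorem mainTheorem1 {n m : ℕ} (s : LinearGaussianSystem n m)
    (hQ : s.Q.PosSemidef) (hR : s.R.PosDef) (hSigma0 : s.Sigma0.PosSemidef)
    (hA : SchurStable s.A) :
    -- the steady-state error and the sensitivity are well defined for every admissible gain
    (∀ K, s.Admissible K →
      Tendsto (s.errorCov K) atTop (𝓝 (s.steadyCov K)) ∧
      ∀ D : Matrix (Fin m) (Fin m) ℝ, D.IsSymm →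
        HasDerivAt (fun ε : ℝ => (s.withR (s.R + ε • D)).perf K)
          ((s.perfGradR K).transpose * D).trace 0) ∧
    -- the Kalman gain is well defined and is the unique minimizer of the steady-state error
    (∃! X, IsRiccatiSolution s.A s.C s.Q s.R X) ∧
    IsUniqueMinimizer s.perf {K | s.Admissible K} s.kalmanGain ∧
    -- the Riccati equation of the theorem has a unique solution, and `K*(lam)` is the unique
    -- minimizer of `𝒮 + lam 𝒫`
    (∀ lam : ℝ, 0 ≤ lam →
      (∃! X, IsRiccatiSolution s.A s.C (lam • s.Q) (1 + lam • s.R) X) ∧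
      IsUniqueMinimizer (fun K => s.sens K + lam * s.perf K) {K | s.Admissible K}
        (s.optGain lam)) ∧
    -- solution of the constrained problem in terms of `lam`
    (∀ δ ∈ Set.Icc (s.perf s.kalmanGain) (s.perf 0), ∀ lam : ℝ, 0 ≤ lam →
      s.perf (s.optGain lam) = δ → IsUniqueMinimizer s.sens (s.feasible δ) (s.optGain lam)) ∧
    -- such a `lam` exists and is unique, except possibly at the left endpoint
    (∀ δ ∈ Set.Ioc (s.perf s.kalmanGain) (s.perf 0),
      ∃! lam : ℝ, 0 ≤ lam ∧ s.perf (s.optGain lam) = δ) ∧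
    s.optGain 0 = 0 ∧
    -- the left endpoint is the limiting case `lam → ∞`
    IsUniqueMinimizer s.sens (s.feasible (s.perf s.kalmanGain)) s.kalmanGain ∧
    Tendsto s.optGain atTop (𝓝 s.kalmanGain) := by
  refine ⟨fun K hK => ⟨?_, fun D hD => ?_⟩,
    LinearGaussianSystem.existsUnique_isRiccatiSolution hA hQ hR,
    LinearGaussianSystem.isUniqueMinimizer_kalmanGain hA hQ hR,
    fun lam hlam => ⟨LinearGaussianSystem.existsUnique_isRiccatiSolution hA (hQ.smul hlam)
      (one_add_smul_posDef hR hlam),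
      LinearGaussianSystem.isUniqueMinimizer_optGain hA hQ hR hlam⟩,
    fun δ _ lam hlam h =>
      LinearGaussianSystem.isUniqueMinimizer_sens_optGain hA hQ hR hlam h,
    fun δ hδ => LinearGaussianSystem.existsUnique_perf_optGain_eq hA hQ hR hδ,
    LinearGaussianSystem.optGain_zero hA,
    LinearGaussianSystem.isUniqueMinimizer_sens_kalmanGain hA hQ hR,
    LinearGaussianSystem.tendsto_optGain_atTop hA hQ hR⟩
  · rw [hK.steadyCov_eq hQ hR.posSemidef]
    exact hK.tendsto_errorCov hQ hR.posSemidef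
  · rw [hK.trace_perfGradR_mul hQ hR hD]
    exact hK.hasDerivAt_perf hQ hR hD
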